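/- Fix countably many propositional variables $p_0,p_1,\dots$. Formulas of the graded two-way modal language $(\Diamond_{\ge},\Diamond^{-}_{\ge})$ are built from the variables by the Boolean connectives ($\top,\bot,\neg,\wedge,\vee,\to,\leftrightarrow$) and by the unary operators $\Diamond_{\ge n}$ and $\Diamond^{-}_{\ge n}$ for every $n\in\mathbb N$; as inputs of algorithms they are written as words over a finite alphabet, with the subscripts $n$ and the indices of variables in binary. Formulas are interpreted in Kripke structures $\mathfrak A=\langle W,R,V\rangle$ with a nonempty set $W$ of worlds, a binary relation $R$ on $W$ and a valuation $V$ mapping variables to subsets of $W$: $\mathfrak A,w\models p$ iff $w\in V(p)$, the Boolean connectives have their usual meaning, $\mathfrak A,w\models\Diamond_{\ge n}\varphi$ iff there are at least $n$ worlds $v$ with $wRv$ and $\mathfrak A,v\models\varphi$, and $\mathfrak A,w\models\Diamond^{-}_{\ge n}\varphi$ iff there are at least $n$ worlds $v$ with $vRw$ and $\mathfrak A,v\models\varphi$. Let $\mathrm{K45}$ be the class of all frames $\langle W,R\rangle$ with $R$ transitive and Euclidean ($xRy$ and $xRz$ imply $yRz$), and let $\mathrm{D45}$ be the class of all frames in $\mathrm{K45}$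 with $R$ also serial (every $x$ has some $y$ with $xRy$). The local (respectively, global) satisfiability problem for $\mathcal F(\Diamond_{\ge},\Diamond^{-}_{\ge})$ asks, given a formula $\varphi$, whether there is a Kripke structure with frame in $\mathcal F$ in which $\varphi$ is satisfied at some world (respectively, at all worlds). **Theorem.** The local and the global satisfiability problems for $\mathrm{K45}(\Diamond_{\ge},\Diamond^{-}_{\ge})$ and for $\mathrm{D45}(\Diamond_{\ge},\Diamond^{-}_{\ge})$, four problems in all, are in $\mathrm{NP}$. -/

import Mathlib

universe u

namespace TwoWayGraded

/-! ### Syntax -/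

/-- Formulas of graded two-way modal logic over the propositional variables `p₀, p₁, p₂, …`:
`dia n φ` is `◇_{≥ n} φ` and `revDia n φ` is `◇⁻_{≥ n} φ`. -/
inductive Formula : Type
  | var (i : ℕ)
  | top
  | bot
  | neg (φ : Formula)
  | and (φ ψ : Formula)
  | or (φ ψ : Formula)
  | imp (φ ψ : Formula)
  | iff (φ ψ : Formula)
  | dia (n : ℕ) (φ : Formula)
  | revDia (n : ℕ) (φ : Formula)

/-- The finite alphabet in which formulas are written. -/
inductive Symb : Type
  | var | top | bot | neg | and | or | imp | iff | dia | revDia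
  | bit (b : Bool)
  deriving DecidableEq, Fintype

/-- The binary numeral of `n` (least significant bit first). -/
def numeral (n : ℕ) : List Symb :=
  (Computability.encodeNat n).map Symb.bit

/-- A formula as a word in prefix notation; counting subscripts and the indices of propositional
variables are written in binary. -/
def Formula.encode : Formula → List Symb
  | .var i => Symb.var :: numeral i
  | .top => [Symb.top]
  | .bot => [Symb.bot]
  | .neg φ => Symb.neg :: φ.encode
  | .and φ ψ => Symb.and :: (φ.encode ++ ψ.encode)
  | .or φ ψ => Symb.or :: (φ.encode ++ ψ.encode)
  | .imp φ ψ => Symb.imp :: (φ.encode ++ ψ.encode)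
  | .iff φ ψ => Symb.iff :: (φ.encode ++ ψ.encode)
  | .dia n φ => Symb.dia :: (numeral n ++ φ.encode)
  | .revDia n φ => Symb.revDia :: (numeral n ++ φ.encode)

/-! ### Semantics -/

/-- Kripke structures: a nonempty set of worlds, an accessibility relation and a valuation. -/
structure KripkeStructure : Type (u + 1) where
  World : Type u
  nonempty : Nonempty World
  R : World → World → Prop
  V : ℕ → Set World

/-- The satisfaction relation. The number of worlds is counted in `ℕ∞`, so that an infinite set
of worlds has at least `n` elements for every `n`. -/
def KripkeStructure.Sat (A : KripkeStructure.{u}) : A.World → Formula → Prop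
  | w, .var i => w ∈ A.V i
  | _, .top => True
  | _, .bot => False
  | w, .neg φ => ¬ A.Sat w φ
  | w, .and φ ψ => A.Sat w φ ∧ A.Sat w ψ
  | w, .or φ ψ => A.Sat w φ ∨ A.Sat w ψ
  | w, .imp φ ψ => A.Sat w φ → A.Sat w ψ
  | w, .iff φ ψ => (A.Sat w φ ↔ A.Sat w ψ)
  | w, .dia n φ => (n : ℕ∞) ≤ {v : A.World | A.R w v ∧ A.Sat v φ}.encard
  | w, .revDia n φ => (n : ℕ∞) ≤ {v : A.World | A.R v w ∧ A.Sat v φ}.encard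

/-- A class of frames. -/
abbrev FrameClass : Type (u + 1) := ∀ W : Type u, (W → W → Prop) → Prop

/-- Transitive Euclidean frames. -/
def K45 : FrameClass.{u} := fun _ R =>
  (∀ x y z, R x y → R y z → R x z) ∧ (∀ x y z, R x y → R x z → R y z)

/-- Serial transitive Euclidean frames. -/
def D45 : FrameClass.{u} := fun W R =>
  (∀ x, ∃ y, R x y) ∧ K45 W R

/-- `φ` is satisfied at some world of some structure whose frame belongs to `F`. -/
def LocallySatisfiable (F : FrameClass.{u}) (φ : Formula) : Prop :=
  ∃ A : KripkeStructure.{u}, F A.World A.R ∧ ∃ w : A.World, A.Sat w φ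

/-- `φ` is satisfied at all worlds of some structure whose frame belongs to `F`. -/
def GloballySatisfiable (F : FrameClass.{u}) (φ : Formula) : Prop :=
  ∃ A : KripkeStructure.{u}, F A.World A.R ∧ ∀ w : A.World, A.Sat w φ

/-- The local satisfiability problem over the class of frames `F`. -/
def localSat (F : FrameClass.{u}) : Language Symb :=
  {x | ∃ φ : Formula, φ.encode = x ∧ LocallySatisfiable F φ}

/-- The global satisfiability problem over the class of frames `F`. -/
def globalSat (F : FrameClass.{u}) : Language Symb :=
  {x | ∃ φ : Formula, φ.encode = x ∧ GloballySatisfiable F φ}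

/-! ### The class NP -/

/-- A language over a finite alphabet is in NP if membership of `x` is witnessed by a binary
certificate of length polynomial in `|x|` that a deterministic Turing machine checks in time
polynomial in the length of its input `(x, y)`. -/
def InNP {Γ : Type} [Fintype Γ] (L : Language Γ) : Prop :=
  ∃ (p : Polynomial ℕ) (verify : List Γ × List Bool → Bool),
    Nonempty (Turing.TM2ComputableInPolyTime
      (Computability.encodingProd (Computability.encodingList Γ)
        (Computability.encodingList Bool)).encode
      Computability.encodingBoolBool.encode verify) ∧
    ∀ x : List Γ, x ∈ L ↔ ∃ y : List Bool, y.length ≤ p.eval x.length ∧ verify (x, y) = true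

/-! ### Unique readability of the encoding -/

theorem numeral_append_inj {m n : ℕ} {s t : List Symb}
    (hs : ∀ b, s.head? ≠ some (Symb.bit b)) (ht : ∀ b, t.head? ≠ some (Symb.bit b))
    (h : numeral m ++ s = numeral n ++ t) : m = n ∧ s = t := by
  have key : ∀ a b : List Bool, a.map Symb.bit ++ s = b.map Symb.bit ++ t → a = b ∧ s = t := by
    intro a
    induction a with
    | nil =>
      intro b hb
      cases b with
      | nil => exact ⟨rfl, by simpa using hb⟩
      | cons c b => exact absurd (by simp_all) (hs c)
    | cons c a ih =>
      intro b hb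
      cases b with
      | nil => exact absurd (by simp [← (show _ = t by simpa using hb)]) (ht c)
      | cons d b =>
        simp only [List.map_cons, List.cons_append, List.cons.injEq, Symb.bit.injEq] at hb
        obtain ⟨h1, h2⟩ := ih b hb.2
        exact ⟨by rw [hb.1, h1], h2⟩
  obtain ⟨h1, h2⟩ := key _ _ h
  exact ⟨by simpa using congrArg Computability.decodeNat h1, h2⟩

theorem Formula.encode_head (φ : Formula) (s : List Symb) (b : Bool) :
    (φ.encode ++ s).head? ≠ some (Symb.bit b) := by
  cases φ <;> simp [Formula.encode]

theorem Formula.encode_append_inj (φ : Formula) : ∀ (ψ : Formula) (s t : List Symb),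
    (∀ b, s.head? ≠ some (Symb.bit b)) → (∀ b, t.head? ≠ some (Symb.bit b)) →
    φ.encode ++ s = ψ.encode ++ t → φ = ψ ∧ s = t := by
  induction φ with
  | var i =>
    intro ψ s t hs ht h
    cases ψ <;> simp only [Formula.encode, List.cons_append, List.cons.injEq, reduceCtorEq,
      false_and, true_and] at h
    obtain ⟨rfl, rfl⟩ := numeral_append_inj hs ht h
    exact ⟨rfl, rfl⟩
  | top | bot =>
    intro ψ s t hs ht h
    cases ψ <;> simp_all [Formula.encode]
  | neg φ ih =>
    intro ψ s t hs ht h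
    cases ψ <;> simp only [Formula.encode, List.cons_append, List.cons.injEq, reduceCtorEq,
      false_and, true_and] at h
    obtain ⟨rfl, rfl⟩ := ih _ _ _ hs ht h
    exact ⟨rfl, rfl⟩
  | and φ χ ih1 ih2 | or φ χ ih1 ih2 | imp φ χ ih1 ih2 | iff φ χ ih1 ih2 =>
    intro ψ s t hs ht h
    cases ψ <;> simp only [Formula.encode, List.cons_append, List.cons.injEq, reduceCtorEq,
      false_and, true_and, List.append_assoc] at h
    obtain ⟨rfl, h'⟩ := ih1 _ _ _ (Formula.encode_head _ _) (Formula.encode_head _ _) h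
    obtain ⟨rfl, rfl⟩ := ih2 _ _ _ hs ht h'
    exact ⟨rfl, rfl⟩
  | dia n φ ih | revDia n φ ih =>
    intro ψ s t hs ht h
    cases ψ <;> simp only [Formula.encode, List.cons_append, List.cons.injEq, reduceCtorEq,
      false_and, true_and, List.append_assoc] at h
    obtain ⟨rfl, h'⟩ := numeral_append_inj (Formula.encode_head _ _) (Formula.encode_head _ _) h
    obtain ⟨rfl, rfl⟩ := ih _ _ _ hs ht h'
    exact ⟨rfl, rfl⟩

/-- Distinct formulas have distinct encodings. -/
theorem Formula.encode_injective : Function.Injective Formula.encode := by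
  intro φ ψ h
  exact (φ.encode_append_inj ψ [] [] (by simp) (by simp) (by simpa using h)).1

end TwoWayGraded

/-! In a transitive Euclidean frame, worlds with a common successor have the same successors. Fix a
world `w`, let `C` be the set of its successors, and let `W` consist of `w` and of all worlds
sharing a successor with `w`. Every world of `W` sees exactly `C`, every world of `C` is seen
exactly from `W`, and worlds of `W` outside `C` have no predecessors (`isComponent_of_K45`). Hence
on `W` the truth of `dia n χ` is constant and the truth of `revDia n χ` depends only on membership
in `C`. The truth of a formula at a world then depends only on the type of the world, namely
membership in `C` and the variables satisfied. So `W` is described by the number of worlds of each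
type, and these numbers matter only through comparisons of a subscript `n ≤ 2 ^ |φ|` with a sum over
a set of types.

Two reductions make this description short. Numbers can be cut off at `2 ^ |φ|` (`le_sum_min_iff`).
Moreover polynomially many types suffice (`exists_small_support`): by pigeonhole, a large support
has two distinct subsets `A`, `B` meeting each relevant set of types equally often, and shifting
weight between `A \ B` and `B \ A` keeps all relevant sums while emptying a type. Together they give
`IsComponent.exists_entries`. Conversely, every nonempty list of entries describes a model in which
accessibility depends only on the target (`ofEntries`). Global truth passes to `W`, and seriality
amounts to an entry in `C`, so one certificate format serves all four problems.

The verifier evaluates the formula from right to left, on a stack of truth vectors indexed by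
entries. For its running time, structured stack programs are compiled to Turing machines
(`Prog.Run.steps`). The class `PT` of functions on tree-coded data is closed under composition,
pairing, case distinction and folds whose states stay polynomially large, which suffices to build
the verifier (`PT.verifier`, `PT.computable`). -/

namespace TwoWayGraded

/-! ### Structured programs for stack machines -/

/-- Structured programs over a family of stacks. `case k P` pops the stack `k` and continues with
the program selected by the popped symbol; `loop k quit P` does so repeatedly, until the popped
symbol satisfies `quit`. -/
inductive Prog {K : Type} (Γ : K → Type) : Type
  | skip
  | push (k : K) (a : Γ k)
  | seq (P Q : Prog Γ)
  | case (k : K) (P : Option (Γ k) → Prog Γ)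
  | loop (k : K) (quit : Option (Γ k) → Bool) (P : Option (Γ k) → Prog Γ)

namespace Prog

variable {K : Type} {Γ : K → Type}

/-- Program points. -/
def Label : Prog Γ → Type
  | skip => Unit
  | push _ _ => Unit
  | seq P Q => P.Label ⊕ Q.Label
  | case _ P => Option (Σ o, (P o).Label)
  | loop _ _ P => Option (Σ o, (P o).Label)

/-- The program point at which a program starts. -/
def entry : (P : Prog Γ) → P.Label
  | skip => ()
  | push _ _ => ()
  | seq P _ => Sum.inl P.entry
  | case _ _ => none
  | loop _ _ _ => none

/-- There are finitely many program points. -/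
@[reducible] def labelFintype [∀ k, Fintype (Γ k)] : (P : Prog Γ) → Fintype P.Label
  | skip => inferInstanceAs (Fintype Unit)
  | push _ _ => inferInstanceAs (Fintype Unit)
  | seq P Q =>
    haveI := P.labelFintype
    haveI := Q.labelFintype
    inferInstanceAs (Fintype (P.Label ⊕ Q.Label))
  | case _ P =>
    haveI := fun o => (P o).labelFintype
    inferInstanceAs (Fintype (Option (Σ o, (P o).Label)))
  | loop _ _ P =>
    haveI := fun o => (P o).labelFintype
    inferInstanceAs (Fintype (Option (Σ o, (P o).Label)))

variable [DecidableEq K]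

/-- `Run P S S' t`: started with stacks `S`, the program `P` halts after `t` steps with
stacks `S'`. -/
inductive Run : Prog Γ → (∀ k, List (Γ k)) → (∀ k, List (Γ k)) → ℕ → Prop
  | skip {S} : Run skip S S 1
  | push {S k a} : Run (push k a) S (Function.update S k (a :: S k)) 1
  | seq {P Q S S' S'' t t'} : Run P S S' t → Run Q S' S'' t' → Run (seq P Q) S S'' (t + t')
  | case {k P S S' t} : Run (P (S k).head?) (Function.update S k (S k).tail) S' t →
      Run (case k P) S S' (1 + t)
  | quit {k quit P S} : quit (S k).head? = true →
      Run (loop k quit P) S (Function.update S k (S k).tail) 1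
  | iter {k quit P S S' S'' t t'} : quit (S k).head? = false →
      Run (P (S k).head?) (Function.update S k (S k).tail) S' t →
      Run (loop k quit P) S' S'' t' → Run (loop k quit P) S S'' (1 + t + t')

/-- The internal states of the compiled machines: the last symbol popped from each stack. -/
abbrev Mem (Γ : K → Type) : Type := ∀ k, Option (Γ k)

/-- Compilation: the statement at a program point, where program points are embedded into the
labels of the machine by `e` and control passes to `x` at the end. -/
def code {Λ : Type} : (P : Prog Γ) → (P.Label → Λ) → Λ → P.Label →
    Turing.TM2.Stmt Γ Λ (Mem Γ)
  | skip, _, x, _ => .goto fun _ => x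
  | push k a, _, x, _ => .push k (fun _ => a) (.goto fun _ => x)
  | seq P Q, e, x, l =>
    match l with
    | Sum.inl l => P.code (fun l => e (Sum.inl l)) (e (Sum.inr Q.entry)) l
    | Sum.inr l => Q.code (fun l => e (Sum.inr l)) x l
  | case k P, e, x, l =>
    match l with
    | none => .pop k (fun v o => Function.update v k o)
        (.goto fun v => e (some ⟨v k, (P (v k)).entry⟩))
    | some ⟨o, l⟩ => (P o).code (fun l => e (some ⟨o, l⟩)) x l
  | loop k quit P, e, x, l =>
    match l with
    | none => .pop k (fun v o => Function.update v k o)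
        (.goto fun v => if quit (v k) then x else e (some ⟨v k, (P (v k)).entry⟩))
    | some ⟨o, l⟩ => (P o).code (fun l => e (some ⟨o, l⟩)) (e none) l

/-- Reachability in exactly `t` steps. -/
def Steps {Λ : Type} (M : Λ → Turing.TM2.Stmt Γ Λ (Mem Γ))
    (c c' : Turing.TM2.Cfg Γ Λ (Mem Γ)) (t : ℕ) : Prop :=
  (flip bind (Turing.TM2.step M))^[t] (some c) = some c'

theorem Steps.trans {Λ : Type} {M : Λ → Turing.TM2.Stmt Γ Λ (Mem Γ)}
    {a b c : Turing.TM2.Cfg Γ Λ (Mem Γ)} {s t : ℕ} (h : Steps M a b s) (h' : Steps M b c t) :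
    Steps M a c (s + t) := by
  unfold Steps at *
  rw [add_comm, Function.iterate_add_apply, h, h']

theorem steps_one {Λ : Type} {M : Λ → Turing.TM2.Stmt Γ Λ (Mem Γ)} {l : Λ} {v : Mem Γ}
    {S : ∀ k, List (Γ k)} : Steps M ⟨some l, v, S⟩ (Turing.TM2.stepAux (M l) v S) 1 := rfl

/-- Compiled programs run as the source program does. -/
theorem Run.steps {P : Prog Γ} {S S' : ∀ k, List (Γ k)} {t : ℕ} (h : Run P S S' t) {Λ : Type}
    (M : Λ → Turing.TM2.Stmt Γ Λ (Mem Γ)) : ∀ (e : P.Label → Λ) (x : Λ),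
    (∀ l, M (e l) = P.code e x l) → ∀ v, ∃ v', Steps M ⟨some (e P.entry), v, S⟩ ⟨some x, v', S'⟩ t := by
  induction h with
  | @skip S =>
    intro e x hM v
    have h1 : M (e (entry Prog.skip)) = .goto fun _ => x := hM _
    have h2 := steps_one (M := M) (l := e (entry Prog.skip)) (v := v) (S := S)
    rw [h1] at h2
    exact ⟨v, h2⟩
  | @push S k a =>
    intro e x hM v
    have h1 : M (e (entry (Prog.push k a))) = .push k (fun _ => a) (.goto fun _ => x) := hM _
    have h2 := steps_one (M := M) (l := e (entry (Prog.push k a))) (v := v) (S := S)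
    rw [h1] at h2
    exact ⟨v, h2⟩
  | @seq P Q _ _ _ _ _ hP hQ ihP ihQ =>
    intro e x hM v
    obtain ⟨v', h1⟩ := ihP (fun l => e (Sum.inl l)) (e (Sum.inr Q.entry))
      (fun l => hM (Sum.inl l)) v
    obtain ⟨v'', h2⟩ := ihQ (fun l => e (Sum.inr l)) x (fun l => hM (Sum.inr l)) v'
    exact ⟨v'', h1.trans h2⟩
  | @case k P S _ _ h ih =>
    intro e x hM v
    have h1 : M (e (entry (Prog.case k P))) = .pop k (fun v o => Function.update v k o)
        (.goto fun v => e (some ⟨v k, (P (v k)).entry⟩)) := hM _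
    have h2 := steps_one (M := M) (l := e (entry (Prog.case k P))) (v := v) (S := S)
    rw [h1] at h2
    -- The type of the label depends on the popped symbol, so the symbol is replaced through an
    -- equation with a free variable instead of by rewriting.
    have key : ∀ o, o = (S k).head? → e (some ⟨o, (P o).entry⟩) =
        e (some ⟨(S k).head?, (P (S k).head?).entry⟩) := by
      rintro _ rfl
      rfl
    simp only [Turing.TM2.stepAux] at h2
    have hk : Function.update v k (S k).head? k = (S k).head? := Function.update_self ..
    rw [key _ hk] at h2
    obtain ⟨v', h3⟩ := ih (fun l => e (some ⟨_, l⟩)) x (fun l => hM (some ⟨_, l⟩)) _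
    exact ⟨v', h2.trans h3⟩
  | @quit k quit P S h =>
    intro e x hM v
    have h1 : M (e (entry (Prog.loop k quit P))) = .pop k (fun v o => Function.update v k o)
        (.goto fun v => if quit (v k) then x else e (some ⟨v k, (P (v k)).entry⟩)) := hM _
    have h2 := steps_one (M := M) (l := e (entry (Prog.loop k quit P))) (v := v) (S := S)
    rw [h1] at h2
    simp only [Turing.TM2.stepAux, Function.update_self, h, if_true] at h2
    exact ⟨_, h2⟩
  | @iter k quit P S _ _ _ _ h hP hL ihP ihL =>
    intro e x hM v
    have h1 : M (e (entry (Prog.loop k quit P))) = .pop k (fun v o => Function.update v k o)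
        (.goto fun v => if quit (v k) then x else e (some ⟨v k, (P (v k)).entry⟩)) := hM _
    have h2 := steps_one (M := M) (l := e (entry (Prog.loop k quit P))) (v := v) (S := S)
    rw [h1] at h2
    have key : ∀ o, o = (S k).head? → (if quit o then x else e (some ⟨o, (P o).entry⟩)) =
        e (some ⟨(S k).head?, (P (S k).head?).entry⟩) := by
      rintro _ rfl
      simp [h]
    simp only [Turing.TM2.stepAux] at h2
    have hk : Function.update v k (S k).head? k = (S k).head? := Function.update_self ..
    rw [key _ hk] at h2
    obtain ⟨v', h3⟩ := ihP (fun l => e (some ⟨_, l⟩)) (e none) (fun l => hM (some ⟨_, l⟩)) _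
    obtain ⟨v'', h4⟩ := ihL e x hM v'
    exact ⟨v'', (h2.trans h3).trans h4⟩

end Prog
end TwoWayGraded

namespace TwoWayGraded

/-! ### Binary trees as data -/

/-- Binary trees, the data type of the verifier. -/
inductive Tree : Type
  | nil
  | cons (a b : Tree)

/-- Prefix notation of a tree. -/
def Tree.ser : Tree → List Bool
  | .nil => [false]
  | .cons a b => true :: (a.ser ++ b.ser)

/-- The length of the prefix notation of a tree. -/
def Tree.size (d : Tree) : ℕ := d.ser.length

@[simp] theorem Tree.size_nil : Tree.nil.size = 1 := rfl

@[simp] theorem Tree.size_cons (a b : Tree) : (Tree.cons a b).size = 1 + a.size + b.size := by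
  simp [Tree.size, Tree.ser]; omega

theorem Tree.size_pos (d : Tree) : 0 < d.size := by
  cases d <;> simp [Nat.add_assoc]

/-- The stacks of the verifier: the input, the main stack holding values, and auxiliary stacks. -/
inductive Stk : Type
  | inp | main | x | y | c
  deriving DecidableEq

instance : Fintype Stk := ⟨{.inp, .main, .x, .y, .c}, by rintro ⟨⟩ <;> decide⟩

/-- The input alphabet of the verifier. -/
abbrev Tok : Type := Symb ⊕ Bool

/-- The stack alphabets. -/
@[reducible] def Alph : Stk → Type
  | .inp => Tok
  | _ => Bool

instance Alph.fintype : ∀ k, Fintype (Alph k)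
  | .inp => inferInstanceAs (Fintype Tok)
  | .main | .x | .y | .c => inferInstanceAs (Fintype Bool)

/-- Assembles the contents of the stacks. -/
def stks (i : List Tok) (m x y c : List Bool) : ∀ k, List (Alph k)
  | .inp => i
  | .main => m
  | .x => x
  | .y => y
  | .c => c

section
variable (i i' : List Tok) (m x y c l : List Bool)

@[simp] theorem stks_inp : stks i m x y c .inp = i := rfl
@[simp] theorem stks_main : stks i m x y c .main = m := rfl
@[simp] theorem stks_x : stks i m x y c .x = x := rfl
@[simp] theorem stks_y : stks i m x y c .y = y := rfl
@[simp] theorem stks_c : stks i m x y c .c = c := rfl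
@[simp] theorem update_stks_inp :
    Function.update (stks i m x y c) .inp i' = stks i' m x y c := by
  funext k; cases k <;> rfl
@[simp] theorem update_stks_main :
    Function.update (stks i m x y c) .main l = stks i l x y c := by
  funext k; cases k <;> rfl
@[simp] theorem update_stks_x :
    Function.update (stks i m x y c) .x l = stks i m l y c := by
  funext k; cases k <;> rfl
@[simp] theorem update_stks_y :
    Function.update (stks i m x y c) .y l = stks i m x l c := by
  funext k; cases k <;> rfl
@[simp] theorem update_stks_c :
    Function.update (stks i m x y c) .c l = stks i m x y l := by
  funext k; cases k <;> rfl

end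

namespace Prog

/-! ### Moving, copying and exchanging values on the stacks. -/

theorem Run.push' {k : Stk} {a : Alph k} {S S' : ∀ k, List (Alph k)}
    (h : Function.update S k (a :: S k) = S') : Run (Prog.push k a) S S' 1 := h ▸ Run.push

theorem Run.quit' {k : Stk} {quit : Option (Alph k) → Bool} {P : Option (Alph k) → Prog Alph}
    {S S' : ∀ k, List (Alph k)} (h : quit (S k).head? = true)
    (h' : Function.update S k (S k).tail = S') : Run (Prog.loop k quit P) S S' 1 := h' ▸ Run.quit h

/-- One iteration of the loop that moves the top value of the main stack to another stack; the
auxiliary stack `c` counts the values still to be moved. -/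
def moveBody (k : Stk) (h : Alph k = Bool) : Prog Alph :=
  case .main fun o => match o with
    | some true => seq (push k (h ▸ true)) (seq (push .c true) (push .c true))
    | _ => seq (push k (h ▸ false)) skip

/-- The loop that moves values from the main stack to another stack. -/
def moveLoop (k : Stk) (h : Alph k = Bool) : Prog Alph :=
  loop .c Option.isNone fun _ => moveBody k h

/-- Moves the top value of the main stack to another stack. -/
def move (k : Stk) (h : Alph k = Bool) : Prog Alph :=
  seq (push .c true) (moveLoop k h)

/-- The stack `c` holds in unary the number of subtrees still owed: each round pays one, and an
inner node adds two. This finds the end of a tree in prefix notation. The continuation form,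
prolonging a given run backwards, lets the two subtrees be composed in the induction. -/
theorem moveLoop_x (d : Tree) : ∀ {i m x y c S' t},
    Run (moveLoop .x rfl) (stks i m (d.ser.reverse ++ x) y c) S' t →
    ∃ t' ≤ t + 5 * d.size, Run (moveLoop .x rfl) (stks i (d.ser ++ m) x y (true :: c)) S' t' := by
  induction d with
  | nil =>
    intro i m x y c S' t h
    refine ⟨1 + (1 + (1 + 1)) + t, by simp; omega, ?_⟩
    refine Run.iter rfl (Run.case (Run.seq (Run.push' rfl) Run.skip)) ?_
    simpa [Tree.ser, moveLoop] using h
  | cons a b iha ihb =>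
    intro i m x y c S' t h
    obtain ⟨t1, ht1, h1⟩ := ihb (i := i) (m := m) (x := a.ser.reverse ++ (true :: x)) (y := y)
      (c := c) (S' := S') (t := t) (by simpa [Tree.ser] using h)
    obtain ⟨t2, ht2, h2⟩ := iha h1
    refine ⟨1 + (1 + (1 + (1 + 1))) + t2, by simp; omega, ?_⟩
    refine Run.iter rfl (Run.case (Run.seq (Run.push' rfl) (Run.seq (Run.push' rfl)
      (Run.push' rfl)))) ?_
    simpa [Tree.ser, moveLoop] using h2

theorem moveLoop_y (d : Tree) : ∀ {i m x y c S' t},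
    Run (moveLoop .y rfl) (stks i m x (d.ser.reverse ++ y) c) S' t →
    ∃ t' ≤ t + 5 * d.size, Run (moveLoop .y rfl) (stks i (d.ser ++ m) x y (true :: c)) S' t' := by
  induction d with
  | nil =>
    intro i m x y c S' t h
    refine ⟨1 + (1 + (1 + 1)) + t, by simp; omega, ?_⟩
    refine Run.iter rfl (Run.case (Run.seq (Run.push' rfl) Run.skip)) ?_
    simpa [Tree.ser, moveLoop] using h
  | cons a b iha ihb =>
    intro i m x y c S' t h
    obtain ⟨t1, ht1, h1⟩ := ihb (i := i) (m := m) (y := a.ser.reverse ++ (true :: y)) (x := x)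
      (c := c) (S' := S') (t := t) (by simpa [Tree.ser] using h)
    obtain ⟨t2, ht2, h2⟩ := iha h1
    refine ⟨1 + (1 + (1 + (1 + 1))) + t2, by simp; omega, ?_⟩
    refine Run.iter rfl (Run.case (Run.seq (Run.push' rfl) (Run.seq (Run.push' rfl)
      (Run.push' rfl)))) ?_
    simpa [Tree.ser, moveLoop] using h2

/-- `P` leads from one assembly of stacks to another within `T` steps. -/
def RunIn (P : Prog Alph) (S S' : ∀ k, List (Alph k)) (T : ℕ) : Prop :=
  ∃ t ≤ T, Run P S S' t

theorem RunIn.seq {P Q : Prog Alph} {S S' S'' : ∀ k, List (Alph k)} {T T' : ℕ}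
    (h : RunIn P S S' T) (h' : RunIn Q S' S'' T') : RunIn (Prog.seq P Q) S S'' (T + T') := by
  obtain ⟨t, ht, h⟩ := h
  obtain ⟨t', ht', h'⟩ := h'
  exact ⟨t + t', add_le_add ht ht', h.seq h'⟩

theorem RunIn.mono {P : Prog Alph} {S S' : ∀ k, List (Alph k)} {T T' : ℕ}
    (h : RunIn P S S' T) (hT : T ≤ T') : RunIn P S S' T' := by
  obtain ⟨t, ht, h⟩ := h
  exact ⟨t, ht.trans hT, h⟩

theorem move_x (d : Tree) (i m x y) :
    RunIn (move .x rfl) (stks i (d.ser ++ m) x y []) (stks i m (d.ser.reverse ++ x) y [])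
      (5 * d.size + 2) := by
  obtain ⟨t, ht, h⟩ := moveLoop_x d (i := i) (m := m) (x := x) (y := y) (c := []) (t := 1)
    (Run.quit rfl)
  refine ⟨1 + t, by omega, Run.seq (Run.push' (update_stks_c ..)) (by simpa using h)⟩

theorem move_y (d : Tree) (i m x y) :
    RunIn (move .y rfl) (stks i (d.ser ++ m) x y []) (stks i m x (d.ser.reverse ++ y) [])
      (5 * d.size + 2) := by
  obtain ⟨t, ht, h⟩ := moveLoop_y d (i := i) (m := m) (x := x) (y := y) (c := []) (t := 1)
    (Run.quit rfl)
  refine ⟨1 + t, by omega, Run.seq (Run.push' (update_stks_c ..)) (by simpa using h)⟩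

/-- Empties the stack `x`. -/
def clear : Prog Alph := loop .x Option.isNone fun _ => skip

theorem clear_run (x i m y c) :
    RunIn clear (stks i m x y c) (stks i m [] y c) (2 * x.length + 1) := by
  induction x with
  | nil => exact ⟨1, by simp, Run.quit' rfl (update_stks_x ..)⟩
  | cons b x ih =>
    obtain ⟨t, ht, h⟩ := ih
    refine ⟨1 + 1 + t, by simp; omega, Run.iter rfl Run.skip ?_⟩
    simpa [clear] using h

/-- Pours the stack `x` onto the main stack. -/
def pourX : Prog Alph := loop .x Option.isNone fun o => push .main (o.getD false)

theorem pourX_run (x i m y c) :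
    RunIn pourX (stks i m x y c) (stks i (x.reverse ++ m) [] y c) (2 * x.length + 1) := by
  induction x generalizing m with
  | nil => exact ⟨1, by simp, Run.quit' rfl (update_stks_x ..)⟩
  | cons b x ih =>
    obtain ⟨t, ht, h⟩ := ih (b :: m)
    refine ⟨1 + 1 + t, by simp; omega, Run.iter rfl Run.push ?_⟩
    simpa [pourX] using h

/-- Pours the stack `y` onto the main stack. -/
def pourY : Prog Alph := loop .y Option.isNone fun o => push .main (o.getD false)

theorem pourY_run (y i m x c) :
    RunIn pourY (stks i m x y c) (stks i (y.reverse ++ m) x [] c) (2 * y.length + 1) := by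
  induction y generalizing m with
  | nil => exact ⟨1, by simp, Run.quit' rfl (update_stks_y ..)⟩
  | cons b y ih =>
    obtain ⟨t, ht, h⟩ := ih (b :: m)
    refine ⟨1 + 1 + t, by simp; omega, Run.iter rfl Run.push ?_⟩
    simpa [pourY] using h

/-- Pours the stack `y` onto the stack `x`. -/
def pourYX : Prog Alph := loop .y Option.isNone fun o => push .x (o.getD false)

theorem pourYX_run (y i m x c) :
    RunIn pourYX (stks i m x y c) (stks i m (y.reverse ++ x) [] c) (2 * y.length + 1) := by
  induction y generalizing x with
  | nil => exact ⟨1, by simp, Run.quit' rfl (update_stks_y ..)⟩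
  | cons b y ih =>
    obtain ⟨t, ht, h⟩ := ih (b :: x)
    refine ⟨1 + 1 + t, by simp; omega, Run.iter rfl Run.push ?_⟩
    simpa [pourYX] using h

/-- Pours the stack `x` onto both the main stack and the stack `y`. -/
def pourBoth : Prog Alph :=
  loop .x Option.isNone fun o => seq (push .main (o.getD false)) (push .y (o.getD false))

theorem pourBoth_run (x i m y c) :
    RunIn pourBoth (stks i m x y c) (stks i (x.reverse ++ m) [] (x.reverse ++ y) c)
      (3 * x.length + 1) := by
  induction x generalizing m y with
  | nil => exact ⟨1, by simp, Run.quit' rfl (update_stks_x ..)⟩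
  | cons b x ih =>
    obtain ⟨t, ht, h⟩ := ih (b :: m) (b :: y)
    refine ⟨1 + (1 + 1) + t, by simp; omega, Run.iter rfl (Run.seq Run.push Run.push) ?_⟩
    simpa [pourBoth] using h

/-- The stacks between the execution of operations on values. -/
abbrev mainStack (m : List Bool) : ∀ k, List (Alph k) := stks [] m [] [] []

/-- Removes the top value. -/
def drop : Prog Alph := seq (move .x rfl) clear

theorem drop_run (d : Tree) (r) :
    RunIn drop (mainStack (d.ser ++ r)) (mainStack r) (7 * d.size + 3) := by
  refine ((move_x d _ _ _ _).seq (clear_run _ _ _ _ _)).mono ?_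
  simp [Tree.size]; omega

/-- Duplicates the top value. -/
def dup : Prog Alph := seq (move .x rfl) (seq pourBoth (seq pourYX pourX))

/-- `pourBoth` leaves one copy on the main stack and one on `y`; the latter passes through `x` so
that two reversals restore its order. -/
theorem dup_run (d : Tree) (r) :
    RunIn dup (mainStack (d.ser ++ r)) (mainStack (d.ser ++ (d.ser ++ r))) (12 * d.size + 5) := by
  have h := (move_x d [] r [] []).seq ((pourBoth_run _ _ _ _ _).seq
    ((pourYX_run _ _ _ _ _).seq (pourX_run _ _ _ _ _)))
  simp only [List.append_nil, List.reverse_reverse] at h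
  refine h.mono ?_
  simp [Tree.size]; omega

/-- Exchanges the two top values. -/
def swap : Prog Alph := seq (move .x rfl) (seq (move .y rfl) (seq pourX pourY))

theorem swap_run (d e : Tree) (r) :
    RunIn swap (mainStack (d.ser ++ (e.ser ++ r))) (mainStack (e.ser ++ (d.ser ++ r)))
      (7 * d.size + 7 * e.size + 6) := by
  have h := (move_x d [] (e.ser ++ r) [] []).seq ((move_y e _ _ _ _).seq
    ((pourX_run _ _ _ _ _).seq (pourY_run _ _ _ _ _)))
  simp only [List.append_nil, List.reverse_reverse] at h
  refine h.mono ?_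
  simp [Tree.size]; omega

end Prog
end TwoWayGraded

namespace TwoWayGraded

/-! ### Functions computed in polynomial time -/

/-- Representation of data by binary trees. -/
class Enc (α : Type) where
  enc : α → Tree


/-- The size of the representation. -/
def sz {α : Type} [Enc α] (a : α) : ℕ := (Enc.enc a).size

instance : Enc Tree := ⟨id⟩

instance : Enc Bool := ⟨fun b => if b then .cons .nil .nil else .nil⟩

instance {α β : Type} [Enc α] [Enc β] : Enc (α × β) := ⟨fun p => .cons (Enc.enc p.1) (Enc.enc p.2)⟩

/-- Lists are represented by right combs. -/
def encList {α : Type} [Enc α] : List α → Tree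
  | [] => .nil
  | a :: l => .cons (Enc.enc a) (encList l)

instance {α : Type} [Enc α] : Enc (List α) := ⟨encList⟩

section
variable {α β : Type} [Enc α] [Enc β]

theorem enc_tree (d : Tree) : Enc.enc d = d := rfl
theorem enc_true : Enc.enc true = .cons .nil .nil := rfl
theorem enc_false : Enc.enc false = .nil := rfl
theorem enc_pair (a : α) (b : β) : Enc.enc (a, b) = .cons (Enc.enc a) (Enc.enc b) := rfl
theorem enc_nil : Enc.enc ([] : List α) = .nil := rfl
theorem enc_cons (a : α) (l : List α) : Enc.enc (a :: l) = .cons (Enc.enc a) (Enc.enc l) := rfl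

@[simp] theorem sz_pair (a : α) (b : β) : sz (a, b) = 1 + sz a + sz b := by simp [sz, enc_pair]
@[simp] theorem sz_nil : sz ([] : List α) = 1 := rfl
@[simp] theorem sz_cons (a : α) (l : List α) : sz (a :: l) = 1 + sz a + sz l := by
  simp [sz, enc_cons]
theorem sz_bool_le (b : Bool) : sz b ≤ 3 := by cases b <;> simp [sz, enc_true, enc_false]
theorem sz_pos (a : α) : 0 < sz a := Tree.size_pos _

theorem length_le_sz (l : List α) : l.length ≤ sz l := by
  induction l with
  | nil => simp
  | cons a l ih => simp; omega

theorem sz_le_sz_append (l l' : List α) : sz l ≤ sz (l ++ l') := by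
  induction l with
  | nil => simpa using Nat.succ_le_of_lt (sz_pos l')
  | cons a l ih => simp; omega

end

theorem eval_mono (p : Polynomial ℕ) : Monotone fun n => p.eval n := by
  intro m n h
  simp only [Polynomial.eval_eq_sum_range]
  gcongr

open Prog Polynomial

/-- `f` is computed in polynomial time on the main stack, and its values are of polynomial size. -/
@[fun_prop]
def PT {α β : Type} [Enc α] [Enc β] (f : α → β) : Prop :=
  ∃ (P : Prog Alph) (p : ℕ[X]), ∀ a, sz (f a) ≤ p.eval (sz a) ∧ ∀ r,
    RunIn P (mainStack ((Enc.enc a).ser ++ r)) (mainStack ((Enc.enc (f a)).ser ++ r)) (p.eval (sz a))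

namespace PT

/-! ### Closure properties of polynomial-time functions. -/

variable {α β γ δ : Type} [Enc α] [Enc β] [Enc γ] [Enc δ]

/-- Programs see only codes, so a function may be replaced by any other, even between different
types, that acts in the same way on codes. -/
theorem of_enc {f : α → β} {g : γ → δ} (hg : PT g) (u : α → γ) (h1 : ∀ a, Enc.enc a = Enc.enc (u a))
    (h2 : ∀ a, Enc.enc (f a) = Enc.enc (g (u a))) : PT f := by
  obtain ⟨P, p, h⟩ := hg
  refine ⟨P, p, fun a => ?_⟩
  have := h (u a)
  simpa only [sz, h1, h2] using this

theorem of_eq {f g : α → β} (hf : PT f) (h : ∀ a, g a = f a) : PT g := by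
  rwa [show g = f from funext h]

@[fun_prop]
theorem id : PT (fun a : α => a) :=
  ⟨skip, X + 1, fun a => ⟨by simp, fun r => ⟨1, by simp, Run.skip⟩⟩⟩

@[fun_prop]
theorem comp {g : β → γ} {f : α → β} (hg : PT g) (hf : PT f) : PT (fun a => g (f a)) := by
  obtain ⟨P, p, hP⟩ := hf
  obtain ⟨Q, q, hQ⟩ := hg
  refine ⟨.seq P Q, p + q.comp p, fun a => ?_⟩
  have h1 : q.eval (sz (f a)) ≤ q.eval (p.eval (sz a)) := eval_mono q (hP a).1
  simp only [eval_add, eval_comp]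
  refine ⟨((hQ _).1.trans h1).trans (by omega), fun r => ?_⟩
  exact (((hP a).2 r).seq ((hQ _).2 r)).mono (by omega)

/-- Pushes a word. -/
def pushWord : List Bool → Prog Alph
  | [] => .skip
  | b :: l => .seq (pushWord l) (.push .main b)

theorem pushWord_run (l r : List Bool) :
    RunIn (pushWord l) (mainStack r) (mainStack (l ++ r)) (l.length + 1) := by
  induction l with
  | nil => exact ⟨1, by simp, Run.skip⟩
  | cons b l ih =>
    exact (ih.seq ⟨1, le_rfl, Run.push' (update_stks_main ..)⟩).mono (by simp)

theorem push_run (b : Bool) (r : List Bool) :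
    RunIn (.push .main b) (mainStack r) (mainStack (b :: r)) 1 :=
  ⟨1, le_rfl, Run.push' (update_stks_main ..)⟩

/-- Pops a symbol. -/
def pop : Prog Alph := .case .main fun _ => .skip

theorem pop_run (b : Bool) (r : List Bool) : RunIn pop (mainStack (b :: r)) (mainStack r) 2 :=
  ⟨1 + 1, le_rfl, Run.case (by simpa using Run.skip)⟩

@[fun_prop]
theorem const (b : β) : PT (fun _ : α => b) := by
  refine ⟨.seq drop (pushWord (Enc.enc b).ser), 7 * X + C (sz b + 4), fun a => ⟨by simp; omega, fun r => ?_⟩⟩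
  refine ((drop_run (Enc.enc a) r).seq (pushWord_run _ _)).mono ?_
  simp only [sz, Tree.size, eval_add, eval_mul, eval_ofNat, eval_X, eval_C]
  omega

@[fun_prop]
theorem pair {f : α → β} {g : α → γ} (hf : PT f) (hg : PT g) : PT (fun a => (f a, g a)) := by
  obtain ⟨P, p, hP⟩ := hf
  obtain ⟨Q, q, hQ⟩ := hg
  -- The second component is computed first because it must lie below the first one; the final
  -- `true` is the pair node.
  refine ⟨.seq dup (.seq Q (.seq swap (.seq P (.push .main true)))),
    20 * X + 20 + p + 10 * q, fun a => ?_⟩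
  obtain ⟨h1, h2⟩ := hP a
  obtain ⟨h3, h4⟩ := hQ a
  refine ⟨by simp; omega, fun r => ?_⟩
  have h := (dup_run (Enc.enc a) r).seq ((h4 _).seq ((swap_run (Enc.enc (g a)) (Enc.enc a) r).seq ((h2 _).seq (push_run true _))))
  simp only [enc_pair, Tree.ser, List.cons_append, List.append_assoc]
  refine h.mono ?_
  simp only [eval_add, eval_mul, eval_ofNat, eval_X]
  simp only [sz] at *
  omega

theorem fst : PT (fun p : α × β => p.1) := by
  refine ⟨.seq pop (.seq swap drop), 20 * X + 20, fun a => ⟨?_, fun r => ?_⟩⟩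
  · obtain ⟨a, b⟩ := a
    simp
    omega
  · obtain ⟨a, b⟩ := a
    simp only [enc_pair, Tree.ser, List.cons_append, List.append_assoc]
    refine ((pop_run _ _).seq ((swap_run _ _ _).seq (drop_run _ _))).mono ?_
    simp [sz, enc_pair]
    omega

theorem snd : PT (fun p : α × β => p.2) := by
  refine ⟨.seq pop drop, 20 * X + 20, fun a => ⟨?_, fun r => ?_⟩⟩
  · obtain ⟨a, b⟩ := a
    simp
    omega
  · obtain ⟨a, b⟩ := a
    simp only [enc_pair, Tree.ser, List.cons_append, List.append_assoc]
    refine ((pop_run _ _).seq (drop_run _ _)).mono ?_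
    simp [sz, enc_pair]
    omega

@[fun_prop]
theorem fst' {f : α → β × γ} (hf : PT f) : PT (fun a => (f a).1) := comp fst hf

@[fun_prop]
theorem snd' {f : α → β × γ} (hf : PT f) : PT (fun a => (f a).2) := comp snd hf

/-- Case distinction on whether a value is represented by a leaf. -/
theorem cases {f : α → β} {g : Tree × Tree → γ} (c : β) (hg : PT g)
    (h : ∀ a, (Enc.enc a = .nil ∧ Enc.enc (f a) = Enc.enc c) ∨
      ∃ x y, Enc.enc a = .cons x y ∧ Enc.enc (f a) = Enc.enc (g (x, y))) : PT f := by
  obtain ⟨P, p, hP⟩ := hg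
  -- Testing the root consumes it. In the second case it is pushed back and serves as the pair node
  -- of `(x, y)`, which has the same code as the inner node.
  refine ⟨.case .main fun o => if o = some true then .seq (.push .main true) P else
    pushWord (Enc.enc c).ser, p + C (sz c + 2), fun a => ?_⟩
  simp only [eval_add, eval_C]
  rcases h a with ⟨h1, h2⟩ | ⟨x, y, h1, h2⟩
  · refine ⟨by simp only [sz, h2]; omega, fun r => ?_⟩
    obtain ⟨t, ht, h3⟩ := pushWord_run (Enc.enc c).ser r
    rw [h1, h2]
    refine ⟨1 + t, ?_, Run.case ?_⟩
    · simp only [sz, Tree.size]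
      omega
    · simpa [Tree.ser] using h3
  · have h4 := hP (x, y)
    have h5 : sz (x, y) = sz a := by rw [sz, sz, h1]; rfl
    have h6 : sz (g (x, y)) = sz (f a) := by rw [sz, sz, h2]
    rw [h5, h6] at h4
    refine ⟨h4.1.trans (by omega), fun r => ?_⟩
    obtain ⟨t, ht, h3⟩ := (push_run true _).seq (h4.2 r)
    refine ⟨1 + t, by omega, Run.case ?_⟩
    rw [h2]
    simpa [h1, Tree.ser, enc_pair, enc_tree] using h3

theorem ite {c : α → Bool} {f g : α → β} (hc : PT c) (hf : PT f) (hg : PT g) :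
    PT (fun a => if c a = true then f a else g a) := by
  obtain ⟨P, p, hP⟩ := hf
  obtain ⟨Q, q, hQ⟩ := hg
  obtain ⟨R, s, hR⟩ := hc
  -- The condition is evaluated on a copy. The code of `true` has three symbols, so two are left to
  -- pop in that branch; the code of `false` has only one.
  refine ⟨.seq dup (.seq R (.case .main fun o => if o = some true then .seq pop (.seq pop P) else Q)),
    12 * X + 12 + p + q + s, fun a => ?_⟩
  obtain ⟨h1, h2⟩ := hP a
  obtain ⟨h3, h4⟩ := hQ a
  simp only [eval_add, eval_mul, eval_ofNat, eval_X]
  refine ⟨by split <;> omega, fun r => ?_⟩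
  have h := ((dup_run (Enc.enc a) r).seq ((hR a).2 _))
  by_cases hca : c a = true
  · simp only [hca, if_true] at h ⊢
    obtain ⟨t, ht, h5⟩ := (pop_run false _).seq ((pop_run false _).seq (h2 r))
    obtain ⟨t', ht', h6⟩ := h
    cases h6 with | seq ha hb =>
    refine ⟨_, ?_, Run.seq ha (Run.seq hb (Run.case (t := t) ?_))⟩
    · simp only [sz] at *
      omega
    · simpa [Tree.ser, enc_true] using h5
  · simp only [hca] at h ⊢
    obtain ⟨t, ht, h5⟩ := h4 r
    obtain ⟨t', ht', h6⟩ := h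
    cases h6 with | seq ha hb =>
    refine ⟨_, ?_, Run.seq ha (Run.seq hb (Run.case (t := t) ?_))⟩
    · simp only [sz] at *
      omega
    · simpa [Tree.ser, enc_false, Bool.not_eq_true _ ▸ hca] using h5

@[fun_prop]
theorem bcond {c : α → Bool} {f g : α → β} (hc : PT c) (hf : PT f) (hg : PT g) :
    PT (fun a => bif c a then f a else g a) :=
  (ite hc hf hg).of_eq fun a => by cases c a <;> rfl

@[fun_prop]
theorem cons {f : α → β} {g : α → List β} (hf : PT f) (hg : PT g) :
    PT (fun a => f a :: g a) :=
  comp (g := fun p : β × List β => p.1 :: p.2)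
    (PT.id.of_enc (fun p => p) (fun _ => rfl) (fun _ => rfl)) (pair hf hg)

@[fun_prop]
theorem tail {f : α → List β} (hf : PT f) : PT (fun a => (f a).tail) :=
  comp (g := fun l : List β => l.tail) (cases ([] : List β) snd (by
    rintro (_ | ⟨b, l⟩)
    · exact Or.inl ⟨rfl, rfl⟩
    · exact Or.inr ⟨_, _, rfl, rfl⟩)) hf

@[fun_prop]
theorem headD {f : α → List β} (hf : PT f) (b : β) : PT (fun a => (f a).headD b) :=
  comp (g := fun l : List β => l.headD b) (cases b fst (by
    rintro (_ | ⟨b, l⟩)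
    · exact Or.inl ⟨rfl, rfl⟩
    · exact Or.inr ⟨_, _, rfl, rfl⟩)) hf

@[fun_prop]
theorem isEmpty {f : α → List β} (hf : PT f) : PT (fun a => (f a).isEmpty) :=
  comp (g := fun l : List β => l.isEmpty) (cases true (const false) (by
    rintro (_ | ⟨b, l⟩)
    · exact Or.inl ⟨rfl, rfl⟩
    · exact Or.inr ⟨_, _, rfl, rfl⟩)) hf

/-- Iterating a polynomial-time step can make the state explode, hence the hypothesis `hq` bounding
the states after all prefixes. Given it, the loop runs at most as often as the list is long, and
each round costs a polynomial in the size of the original input. -/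
theorem foldl {f : α → List β} {g : α → δ} {h : α → δ → β → δ} (hf : PT f) (hg : PT g)
    (hh : PT (fun p : α × δ × β => h p.1 p.2.1 p.2.2)) (q : ℕ[X])
    (hq : ∀ a l, l <+: f a → sz (l.foldl (h a) (g a)) ≤ q.eval (sz a)) :
    PT (fun a => (f a).foldl (h a) (g a)) := by
  have hH : PT (fun z : (β × List β) × (α × δ) => (z.1.2, (z.2.1, h z.2.1 z.2.2 z.1.1))) :=
    pair (comp snd fst) (pair (comp fst snd) (comp hh
      (pair (comp fst snd) (pair (comp snd snd) (comp fst fst)))))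
  have hS : PT (fun a => (f a, (a, g a))) := pair hf (pair id hg)
  obtain ⟨P, p, hP⟩ := hH
  obtain ⟨R, s, hR⟩ := hS
  obtain ⟨Q, q', hQ⟩ := snd (α := α) (β := δ)
  obtain ⟨_, pf, hpf⟩ := hf
  -- The popped `true` is the root of the remaining list `b :: l`. The two pushed symbols turn what
  -- is left into the code of `((b, l), (a, s))`, and after `P` the last `pop` removes the outer
  -- pair node, leaving the list `l` on top of `(a, s')`.
  let L : Prog Alph := .loop .main (fun o => o != some true) fun _ =>
    .seq (.push .main true) (.seq (.push .main true) (.seq P pop))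
  let N : ℕ[X] := 2 + pf + X + q
  have key : ∀ a r l pre, pre ++ l = f a →
      RunIn L (mainStack ((Enc.enc l).ser ++ ((Enc.enc (a, pre.foldl (h a) (g a))).ser ++ r)))
        (mainStack ((Enc.enc (a, (f a).foldl (h a) (g a))).ser ++ r))
        (1 + l.length * (5 + p.eval (N.eval (sz a)))) := by
    intro a r l
    induction l with
    | nil =>
      intro pre hpre
      rw [List.append_nil] at hpre
      rw [hpre]
      exact ⟨1, by simp, Run.quit' rfl (update_stks_main ..)⟩
    | cons b l ih =>
      intro pre hpre
      obtain ⟨t, ht, hI⟩ := ih (pre ++ [b]) (by simpa using hpre)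
      have hb := (hP ((b, l), (a, pre.foldl (h a) (g a)))).2 r
      have hsz : sz ((b, l), (a, pre.foldl (h a) (g a))) ≤ N.eval (sz a) := by
        have h1 := hq a pre ⟨b :: l, hpre⟩
        have h2 := (hpf a).1
        have h3 : sz (b :: l) ≤ sz (f a) := by
          rw [← hpre]
          generalize b :: l = l'
          clear hpre hI ht ih hb h1
          induction pre with
          | nil => simp
          | cons c pre ih => simp; omega
        simp only [sz_cons] at h3
        simp only [N, sz_pair, eval_add, eval_ofNat, eval_X]
        omega
      have hb := hb.mono (eval_mono p hsz)
      obtain ⟨t', ht', hB⟩ := (push_run true _).seq ((push_run true _).seq (hb.seq (pop_run true _)))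
      refine ⟨1 + t' + t, ?_, Run.iter (t := t') rfl ?_ hI⟩
      · simp only [List.length_cons, add_mul, one_mul]
        simp only [] at ht'
        omega
      · simpa [enc_pair, enc_cons, Tree.ser] using hB
  refine ⟨.seq R (.seq pop (.seq L Q)), s + (3 + pf * (5 + p.comp N)) + q'.comp N + q, fun a => ?_⟩
  simp only [eval_add, eval_mul, eval_ofNat, eval_comp]
  have h1 := hq a (f a) List.prefix_rfl
  refine ⟨by omega, fun r => ?_⟩
  have h2 := (hR a).2 r
  have h3 := key a r (f a) [] rfl
  have h4 := (hQ (a, (f a).foldl (h a) (g a))).2 r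
  have h5 : sz (a, (f a).foldl (h a) (g a)) ≤ N.eval (sz a) := by
    simp only [N, sz_pair, eval_add, eval_ofNat, eval_X]
    omega
  have h4 := h4.mono (eval_mono q' h5)
  simp only [enc_pair, Tree.ser, List.cons_append, List.append_assoc, List.foldl_nil] at h2 h3 h4
  refine (h2.seq ((pop_run _ _).seq (h3.seq h4))).mono ?_
  have h6 : (f a).length * (5 + p.eval (N.eval (sz a))) ≤ pf.eval (sz a) * (5 + p.eval (N.eval (sz a))) :=
    Nat.mul_le_mul_right _ ((length_le_sz _).trans (hpf a).1)
  omega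

end PT
end TwoWayGraded

namespace TwoWayGraded

open Prog Polynomial

/-! ### Finite types and the Turing machine -/

/-- Unary representation of numbers. -/
def unary : ℕ → Tree
  | 0 => .nil
  | n + 1 => .cons .nil (unary n)

noncomputable instance Enc.tok : Enc Tok := ⟨fun t => unary (Fintype.equivFin Tok t)⟩

theorem sz_tok_le (t : Tok) : sz t ≤ 2 * Fintype.card Tok + 1 := by
  have key : ∀ n, (unary n).size = 2 * n + 1 := by
    intro n
    induction n with
    | zero => rfl
    | succ n ih => simp [unary, ih]; omega
  have := (Fintype.equivFin Tok t).isLt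
  simp only [sz, Enc.enc, key]
  omega

namespace PT

variable {α β γ δ : Type} [Enc α] [Enc β] [Enc γ] [Enc δ]

/-- Unary numbers, as data. -/
structure Unary where
  val : ℕ

instance Unary.enc : Enc Unary := ⟨fun n => unary n.val⟩

theorem unary_eq (k : ℕ) : PT (fun n : Unary => decide (n.val = k)) := by
  induction k with
  | zero =>
    refine cases true (const (α := Tree × Tree) false) ?_
    rintro ⟨_ | n⟩
    · exact Or.inl ⟨rfl, rfl⟩
    · exact Or.inr ⟨_, _, rfl, rfl⟩
  | succ k ih =>
    have hpred : PT (fun n : Unary => Unary.mk n.val.pred) := by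
      refine cases (Unary.mk 0) (snd (α := Tree) (β := Tree)) ?_
      rintro ⟨_ | n⟩
      · exact Or.inl ⟨rfl, rfl⟩
      · exact Or.inr ⟨_, _, rfl, rfl⟩
    have hzero : PT (fun n : Unary => decide (n.val = 0)) := by
      refine cases true (const (α := Tree × Tree) false) ?_
      rintro ⟨_ | n⟩
      · exact Or.inl ⟨rfl, rfl⟩
      · exact Or.inr ⟨_, _, rfl, rfl⟩
    refine (ite hzero (const false) (comp ih hpred)).of_eq ?_
    rintro ⟨_ | n⟩ <;> simp

theorem tok_eq (t : Tok) : PT (fun a : Tok => decide (a = t)) :=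
  (unary_eq (Fintype.equivFin Tok t)).of_enc (fun a => ⟨Fintype.equivFin Tok a⟩) (fun _ => rfl)
    (fun a => by simp [Fin.val_inj])

/-- Case distinction on a token. -/
theorem tokCases {h : Tok → α → β} (hh : ∀ t, PT (h t)) : PT (fun p : α × Tok => h p.2 p.1) := by
  -- Tokens are tested one after the other. Outside the list of tested tokens the function is
  -- arbitrary, which no longer matters once the list contains all tokens.
  have key : ∀ L : List Tok, ∃ g : α × Tok → β, PT g ∧ ∀ p, p.2 ∈ L → g p = h p.2 p.1 := by
    intro L
    induction L with
    | nil => exact ⟨fun p => h (.inr true) p.1, comp (hh _) fst, by simp⟩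
    | cons t L ih =>
      obtain ⟨g, hg, hgL⟩ := ih
      refine ⟨_, ite (comp (tok_eq t) snd) (comp (hh t) fst) hg, ?_⟩
      rintro ⟨a, s⟩ hs
      by_cases hst : s = t
      · simp [hst]
      · simp only [hst, decide_false, Bool.false_eq_true, if_false]
        exact hgL _ (by simpa [hst] using hs)
  obtain ⟨g, hg, hgL⟩ := key Finset.univ.toList
  exact hg.of_eq fun p => (hgL p (by simp)).symm

/-- Reads the input into the list of its symbols on the main stack, in reverse order. -/
noncomputable def readInput : Prog Alph :=
  .seq (.push .main false) (.loop .inp Option.isNone fun o =>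
    .seq (pushWord (o.elim [] fun t => (Enc.enc t).ser)) (.push .main true))

theorem readInput_run (l : List Tok) :
    RunIn readInput (stks l [] [] [] []) (mainStack (Enc.enc l.reverse).ser)
      (2 + l.length * (2 * Fintype.card Tok + 4)) := by
  have key : ∀ l l' : List Tok, RunIn (.loop .inp Option.isNone fun o =>
      .seq (pushWord (o.elim [] fun t => (Enc.enc t).ser)) (.push .main true))
      (stks l (Enc.enc l').ser [] [] []) (mainStack (Enc.enc (l.reverse ++ l')).ser)
      (1 + l.length * (2 * Fintype.card Tok + 4)) := by
    intro l
    induction l with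
    | nil =>
      intro l'
      exact ⟨1, by simp, Run.quit' rfl (update_stks_inp ..)⟩
    | cons t l ih =>
      intro l'
      obtain ⟨n, hn, h⟩ := ih (t :: l')
      have hw : ∀ (w r : List Bool), RunIn (pushWord w) (stks l r [] [] [])
          (stks l (w ++ r) [] [] []) (w.length + 1) := by
        intro w r
        induction w with
        | nil => exact ⟨1, by simp, Run.skip⟩
        | cons b w ih =>
          exact (ih.seq ⟨1, le_rfl, Run.push' (update_stks_main ..)⟩).mono (by simp)
      obtain ⟨n', hn', h'⟩ := (hw (Enc.enc t).ser (Enc.enc l').ser).seq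
        ⟨1, le_rfl, Run.push' (k := .main) (a := true) (update_stks_main ..)⟩
      have hs := sz_tok_le t
      refine ⟨1 + n' + n, ?_, Run.iter rfl (by simpa using h') ?_⟩
      · simp only [List.length_cons, add_mul, one_mul]
        simp only [sz, Tree.size] at hs
        omega
      · simpa [enc_cons, Tree.ser] using h
  have h1 : RunIn (.push .main false) (stks l [] [] [] []) (stks l (Enc.enc ([] : List Tok)).ser [] [] []) 1 :=
    ⟨1, le_rfl, Run.push' (update_stks_main ..)⟩
  have h2 := h1.seq (key l [])
  rw [List.append_nil] at h2
  exact h2.mono (by omega)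

/-- Turns a truth value on the main stack into one symbol. -/
def writeOutput : Prog Alph :=
  .case .main fun o => if o = some true then .seq pop (.seq pop (.push .main true))
    else .push .main false

theorem writeOutput_run (b : Bool) :
    RunIn writeOutput (mainStack (Enc.enc b).ser) (mainStack [b]) 6 := by
  cases b with
  | true =>
    obtain ⟨t, ht, h⟩ := (pop_run false [false]).seq ((pop_run false []).seq (push_run true []))
    exact ⟨1 + t, by omega, Run.case (by simpa [enc_true, Tree.ser] using h)⟩
  | false =>
    obtain ⟨t, ht, h⟩ := push_run false []
    exact ⟨1 + t, by omega, Run.case (by simpa [enc_false, Tree.ser] using h)⟩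

/-- The Turing machine of a program. -/
def machine (P : Prog Alph) : Turing.FinTM2 :=
  letI := P.labelFintype
  { K := Stk
    k₀ := .inp
    k₁ := .main
    Γ := Alph
    Λ := Option P.Label
    main := some P.entry
    σ := Mem Alph
    initialState := fun _ => none
    Γk₀Fin := inferInstanceAs (Fintype Tok)
    m := fun l => match l with
      | some l => P.code some none l
      -- The final configuration required of the machine has the initial internal state, so the
      -- registers are reset before halting, at the cost of one step.
      | none => .load (fun _ _ => none) .halt }

/-- A function computed in polynomial time by a program is computed in polynomial time by a
Turing machine. -/
theorem computable {f : List Tok → Bool} (hf : PT f) :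
    Nonempty (Turing.TM2ComputableInPolyTime
      (Computability.encodingProd (Computability.encodingList Symb)
        (Computability.encodingList Bool)).encode
      Computability.encodingBoolBool.encode
      fun p => f (p.1.map Sum.inl ++ p.2.map Sum.inr).reverse) := by
  obtain ⟨P, p, hP⟩ := hf
  have hsz : ∀ l : List Tok, sz l ≤ 1 + l.length * (2 * Fintype.card Tok + 2) := by
    intro l
    induction l with
    | nil => simp
    | cons t l ih =>
      have := sz_tok_le t
      simp only [sz_cons, List.length_cons, add_mul, one_mul]
      omega
  let C' := 2 * Fintype.card Tok
  refine ⟨⟨⟨machine (.seq readInput (.seq P writeOutput)), Equiv.refl _, Equiv.refl _⟩,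
    2 + X * C (C' + 4) + p.comp (1 + X * C (C' + 2)) + 6 + 1, ?_⟩⟩
  intro a
  set l : List Tok := a.1.map Sum.inl ++ a.2.map Sum.inr with hl
  have hle : sz l.reverse ≤ 1 + l.length * (C' + 2) := by
    simpa only [List.length_reverse] using hsz l.reverse
  have h1 := (hP l.reverse).2 []
  rw [List.append_nil, List.append_nil] at h1
  have h := (readInput_run l).seq ((h1.mono (eval_mono p hle)).seq (writeOutput_run (f l.reverse)))
  have hex : ∃ t ≤ 2 + l.length * (C' + 4) + p.eval (1 + l.length * (C' + 2)) + 6 + 1,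
      (flip bind (machine (.seq readInput (.seq P writeOutput))).step)^[t]
        (some (Turing.initList (machine (.seq readInput (.seq P writeOutput))) l)) =
        some (Turing.haltList (machine (.seq readInput (.seq P writeOutput))) [f l.reverse]) := by
    obtain ⟨t, ht, h⟩ := h
    obtain ⟨v, hs⟩ := h.steps (machine (.seq readInput (.seq P writeOutput))).m some none
      (fun _ => rfl) (fun _ => none)
    refine ⟨t + 1, by simp only [C'] at *; omega, ?_⟩
    have h2 : Turing.initList (machine (.seq readInput (.seq P writeOutput))) l =
        ⟨some (some (entry (.seq readInput (.seq P writeOutput)))), fun _ => none,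
          stks l [] [] [] []⟩ := by
      unfold Turing.initList
      congr 1
      funext k
      cases k <;> rfl
    have h3 : Turing.haltList (machine (.seq readInput (.seq P writeOutput))) [f l.reverse] =
        ⟨none, fun _ => none, mainStack [f l.reverse]⟩ := by
      unfold Turing.haltList
      congr 1
      funext k
      cases k <;> rfl
    rw [h2, h3]
    exact hs.trans steps_one
  refine ⟨⟨hex.choose, ?_⟩, ?_⟩
  · have h2 := hex.choose_spec.2
    have h3 : (Computability.encodingProd (Computability.encodingList Symb)
        (Computability.encodingList Bool)).encode a = l := rfl
    have h4 : Computability.encodingBoolBool.encode (f l.reverse) = [f l.reverse] := rfl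
    rw [h3, h4]
    convert h2 using 2
    · exact congrArg (fun l => some (Turing.initList _ l)) (List.map_id _)
    · rfl
  · have h2 := hex.choose_spec.1
    have h3 : (Computability.encodingProd (Computability.encodingList Symb)
        (Computability.encodingList Bool)).encode a = l := rfl
    have h4 : hex.choose ≤ eval l.length (2 + X * C (C' + 4) + p.comp (1 + X * C (C' + 2)) + 6 + 1) := by
      simpa using h2
    exact h4.trans_eq (by rw [h3])

end PT
end TwoWayGraded

namespace TwoWayGraded

open Prog Polynomial

/-! ### List functions computed in polynomial time -/

namespace PT

variable {α β γ δ : Type} [Enc α] [Enc β] [Enc γ] [Enc δ]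

theorem sz_le_of_mem {b : β} {l : List β} (h : b ∈ l) : sz b ≤ sz l := by
  induction l with
  | nil => simp at h
  | cons c l ih =>
    rcases List.mem_cons.1 h with rfl | h
    · simp; omega
    · have := ih h
      simp
      omega

/-- Folds in which the size of the state grows by a bounded amount in every step. -/
theorem foldl_add {f : α → List β} {g : α → δ} {h : α → δ → β → δ} (c : ℕ[X])
    (hc : ∀ a s, ∀ b ∈ f a, sz (h a s b) ≤ sz s + c.eval (sz a)) (hf : PT f) (hg : PT g)
    (hh : PT (fun p : α × δ × β => h p.1 p.2.1 p.2.2)) :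
    PT (fun a => (f a).foldl (h a) (g a)) := by
  have hf' := hf
  obtain ⟨_, pf, hpf⟩ := hf'
  have hg' := hg
  obtain ⟨_, pg, hpg⟩ := hg'
  refine foldl hf hg hh (pg + pf * c) ?_
  intro a l hl
  have key : ∀ (l : List β) (s : δ), (∀ b ∈ l, b ∈ f a) →
      sz (l.foldl (h a) s) ≤ sz s + l.length * c.eval (sz a) := by
    intro l
    induction l with
    | nil => simp
    | cons b l ih =>
      intro s hs
      have h1 := ih (h a s b) fun b hb => hs b (by simp [hb])
      have h2 := hc a s b (hs b (by simp))
      simp only [List.foldl_cons, List.length_cons, add_mul, one_mul]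
      omega
  have h1 := key l (g a) fun b hb => hl.subset hb
  have h2 : l.length * c.eval (sz a) ≤ pf.eval (sz a) * c.eval (sz a) :=
    Nat.mul_le_mul_right _ ((hl.length_le.trans (length_le_sz _)).trans (hpf a).1)
  have h3 := (hpg a).1
  simp only [eval_add, eval_mul]
  omega

@[fun_prop]
theorem reverse {f : α → List β} (hf : PT f) : PT (fun a => (f a).reverse) := by
  have h1 : PT (fun l : List β => l.foldl (fun acc b => b :: acc) []) := by
    refine foldl_add (α := List β) (f := fun l => l) (h := fun _ acc b => b :: acc) (1 + X) ?_
      (by fun_prop) (by fun_prop) (by fun_prop)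
    intro l s b hb
    have := sz_le_of_mem hb
    simp
    omega
  have h2 : PT (fun l : List β => l.reverse) := h1.of_eq fun l => by
    simp
  exact h2.comp hf

@[fun_prop]
theorem map {f : α → List β} {h : α → β → γ} (hh : PT (fun p : α × β => h p.1 p.2)) (hf : PT f) :
    PT (fun a => (f a).map (h a)) := by
  have hf' := hf
  obtain ⟨_, pf, hpf⟩ := hf'
  have hh' := hh
  obtain ⟨_, ph, hph⟩ := hh'
  have h1 : PT (fun a => (f a).foldl (fun acc b => h a b :: acc) []) := by
    refine foldl_add (f := f) (h := fun a acc b => h a b :: acc) (1 + ph.comp (1 + X + pf)) ?_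
      (by fun_prop) (by fun_prop) (by fun_prop)
    intro a s b hb
    have h1 := (sz_le_of_mem hb).trans (hpf a).1
    have h2 : sz (h a b) ≤ ph.eval (sz (a, b)) := (hph (a, b)).1
    have h3 : sz (a, b) ≤ (1 + X + pf).eval (sz a) := by simp; omega
    have h4 := eval_mono ph h3
    simp only [sz_cons, eval_add, eval_one, eval_comp] at h4 ⊢
    omega
  have h2 : PT (fun a => ((f a).foldl (fun acc b => h a b :: acc) []).reverse) := reverse h1
  exact h2.of_eq fun a => by simp

@[fun_prop]
theorem zip [Inhabited γ] {f : α → List β} {g : α → List γ} (hf : PT f) (hg : PT g) :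
    PT (fun a => (f a).zip (g a)) := by
  -- The state is the unread rest of the second list with the pairs so far in reverse order; the
  -- default element is never used, since emptiness is tested before.
  let step : List γ × List (β × γ) → β → List γ × List (β × γ) := fun s b =>
    bif s.1.isEmpty then s else (s.1.tail, (b, s.1.headD default) :: s.2)
  have h1 : PT (fun p : List β × List γ => p.1.foldl step (p.2, [])) := by
    refine foldl_add (f := fun p : List β × List γ => p.1) (h := fun _ => step) (3 + X) ?_
      (by fun_prop) (by fun_prop) (by fun_prop)
    rintro ⟨l1, l2⟩ ⟨s1, s2⟩ b hb
    have h : sz b ≤ sz l1 := sz_le_of_mem hb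
    cases s1 <;> simp [step]; omega
  have key : ∀ (l1 : List β) (l2 : List γ) acc, ((l1.foldl step (l2, acc)).2).reverse =
      acc.reverse ++ l1.zip l2 := by
    intro l1
    induction l1 with
    | nil => simp
    | cons b l1 ih =>
      intro l2 acc
      cases l2 with
      | nil =>
        have h2 : step ([], acc) b = ([], acc) := rfl
        rw [List.foldl_cons, h2, ih]
        simp
      | cons c l2 =>
        have h2 : step (c :: l2, acc) b = (l2, (b, c) :: acc) := rfl
        rw [List.foldl_cons, h2, ih]
        simp
  have h2 : PT (fun p : List β × List γ => p.1.zip p.2) :=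
    (show PT (fun p : List β × List γ => ((p.1.foldl step (p.2, [])).2).reverse) by
      fun_prop).of_eq fun p => by simp [key]
  exact h2.comp (f := fun a => (f a, g a)) (by fun_prop)

@[fun_prop]
theorem bnot {f : α → Bool} (hf : PT f) : PT (fun a => !(f a)) :=
  (show PT (fun a => bif f a then false else true) by fun_prop).of_eq fun a => by
    cases f a <;> rfl

@[fun_prop]
theorem band {f g : α → Bool} (hf : PT f) (hg : PT g) : PT (fun a => f a && g a) :=
  (show PT (fun a => bif f a then g a else false) by fun_prop).of_eq fun a => by
    cases f a <;> rfl

@[fun_prop]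
theorem bor {f g : α → Bool} (hf : PT f) (hg : PT g) : PT (fun a => f a || g a) :=
  (show PT (fun a => bif f a then true else g a) by fun_prop).of_eq fun a => by
    cases f a <;> rfl

@[fun_prop]
theorem bbeq {f g : α → Bool} (hf : PT f) (hg : PT g) : PT (fun a => f a == g a) :=
  (show PT (fun a => bif f a then g a else !(g a)) by fun_prop).of_eq fun a => by
    cases f a <;> cases g a <;> rfl

@[fun_prop]
theorem any {f : α → List β} {h : α → β → Bool} (hf : PT f)
    (hh : PT (fun p : α × β => h p.1 p.2)) : PT (fun a => (f a).any (h a)) := by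
  have h1 : PT (fun a => (f a).foldl (fun r b => r || h a b) false) := by
    refine foldl_add (f := f) (h := fun a r b => r || h a b) 3 ?_
      (by fun_prop) (by fun_prop) (by fun_prop)
    intro a s b _
    have := sz_bool_le (s || h a b)
    simp only [eval_ofNat]
    omega
  refine h1.of_eq fun a => ?_
  have key : ∀ (l : List β) r, l.foldl (fun r b => r || h a b) r = (r || l.any (h a)) := by
    intro l
    induction l with
    | nil => simp
    | cons b l ih => intro r; simp [ih, Bool.or_assoc]
  simp [key]

@[fun_prop]
theorem all {f : α → List β} {h : α → β → Bool} (hf : PT f)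
    (hh : PT (fun p : α × β => h p.1 p.2)) : PT (fun a => (f a).all (h a)) :=
  (show PT (fun a => !((f a).any fun b => !(h a b))) by fun_prop).of_eq fun a => by
    simp [List.all_eq_not_any_not]

/-- Equality of words. -/
@[fun_prop]
theorem wordEq {f g : α → List Bool} (hf : PT f) (hg : PT g) : PT (fun a => f a == g a) := by
  -- The state is the unread rest of the first word and the verdict so far. The emptiness test keeps
  -- the default head from counting as a match.
  let step : List Bool × Bool → Bool → List Bool × Bool := fun s b =>
    (s.1.tail, s.2 && (!s.1.isEmpty && (s.1.headD false == b)))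
  have h1 : PT (fun p : List Bool × List Bool => p.2.foldl step (p.1, true)) := by
    refine foldl_add (f := fun p : List Bool × List Bool => p.2) (h := fun _ => step) 3 ?_
      (by fun_prop) (by fun_prop) (by fun_prop)
    rintro - ⟨s, r⟩ b -
    have h1 := sz_bool_le (r && (!s.isEmpty && (s.headD false == b)))
    have h2 : sz s.tail ≤ sz s := by cases s <;> simp
    simp only [step, sz_pair, eval_ofNat]
    omega
  have key : ∀ (l2 l1 : List Bool) r, ((l2.foldl step (l1, r)).2 && (l2.foldl step (l1, r)).1.isEmpty) =
      (r && (l1 == l2)) := by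
    intro l2
    induction l2 with
    | nil => intro l1 r; cases l1 <;> simp
    | cons b l2 ih =>
      intro l1 r
      rw [List.foldl_cons]
      cases l1 with
      | nil =>
        have h2 : step ([], r) b = ([], false) := by simp [step]
        rw [h2, ih]
        simp
      | cons c l1 =>
        have h2 : step (c :: l1, r) b = (l1, r && (c == b)) := by simp [step]
        rw [h2, ih]
        simp [Bool.and_assoc]
  have h2 : PT (fun p : List Bool × List Bool => p.1 == p.2) :=
    (show PT (fun p : List Bool × List Bool => (p.2.foldl step (p.1, true)).2 &&
      (p.2.foldl step (p.1, true)).1.isEmpty) by fun_prop).of_eq fun p => by simp [key]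
  exact h2.comp (f := fun a => (f a, g a)) (by fun_prop)

end PT

/-! ### Binary arithmetic -/

/-- The number with a given binary expansion, least significant bit first. -/
def val : List Bool → ℕ
  | [] => 0
  | b :: l => b.toNat + 2 * val l

/-- One step of addition with carry; the sum is accumulated in reverse order. -/
def addStep (s : List Bool × List Bool × Bool × List Bool) (_ : Bool) :
    List Bool × List Bool × Bool × List Bool :=
  let x := s.1.headD false
  let y := s.2.1.headD false
  let c := s.2.2.1
  (s.1.tail, s.2.1.tail, ((x && y) || (c && (x || y))), ((x ^^ y) ^^ c) :: s.2.2.2)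

/-- The binary expansion of `val a + val b + 1`. -/
def addSucc (a b : List Bool) : List Bool :=
  let s := b.foldl addStep (a.foldl addStep (a, b, true, []))
  (s.2.2.1 :: s.2.2.2).reverse

theorem val_reverse_cons (b : Bool) (l : List Bool) :
    val (b :: l).reverse = val l.reverse + 2 ^ l.length * b.toNat := by
  have key : ∀ l : List Bool, val (l ++ [b]) = val l + 2 ^ l.length * b.toNat := by
    intro l
    induction l with
    | nil => simp [val]
    | cons c l ih => simp [val, ih, pow_succ]; ring
  simp [key]

theorem val_tail (l : List Bool) : (l.headD false).toNat + 2 * val l.tail = val l := by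
  cases l <;> simp [val]

/-- The invariant of addition with carry: the digits written plus the unread parts and the carry,
shifted to the current position, have a constant sum. -/
theorem val_addStep (s) (b : Bool) :
    val (addStep s b).2.2.2.reverse + 2 ^ (addStep s b).2.2.2.length *
      (val (addStep s b).1 + val (addStep s b).2.1 + (addStep s b).2.2.1.toNat) =
    val s.2.2.2.reverse + 2 ^ s.2.2.2.length * (val s.1 + val s.2.1 + s.2.2.1.toNat) := by
  obtain ⟨a, b, c, o⟩ := s
  simp only [addStep, val_reverse_cons, List.length_cons, pow_succ]
  rw [← val_tail a, ← val_tail b, add_assoc, mul_assoc, ← mul_add]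
  congr 2
  cases a.headD false <;> cases b.headD false <;> cases c <;> simp <;> ring

/-- The `1` is the initial carry, convenient because entries record a number minus one. After
`a.length + b.length` rounds both words are exhausted, so the invariant leaves only the output with
the last carry as its top digit. -/
theorem val_addSucc (a b : List Bool) : val (addSucc a b) = val a + val b + 1 := by
  have h1 : ∀ (l : List Bool) s, val (l.foldl addStep s).2.2.2.reverse +
      2 ^ (l.foldl addStep s).2.2.2.length * (val (l.foldl addStep s).1 +
        val (l.foldl addStep s).2.1 + (l.foldl addStep s).2.2.1.toNat) =
      val s.2.2.2.reverse + 2 ^ s.2.2.2.length * (val s.1 + val s.2.1 + s.2.2.1.toNat) := by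
    intro l
    induction l with
    | nil => simp
    | cons b l ih => intro s; rw [List.foldl_cons, ih, val_addStep]
  have h2 : ∀ (l : List Bool) s, (l.foldl addStep s).1 = s.1.drop l.length ∧
      (l.foldl addStep s).2.1 = s.2.1.drop l.length := by
    intro l
    induction l with
    | nil => simp
    | cons b l ih => intro s; simp [ih, addStep]
  have h3 := h1 b (a.foldl addStep (a, b, true, []))
  rw [h1 a] at h3
  have h4 := h2 b (a.foldl addStep (a, b, true, []))
  have h5 := h2 a (a, b, true, [])
  rw [h4.1, h4.2, h5.1, h5.2] at h3
  rw [addSucc, val_reverse_cons]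
  rw [List.drop_eq_nil_of_le (as := List.drop a.length a) (by simp), List.drop_drop,
    List.drop_eq_nil_of_le (as := b) (by simp)] at h3
  simpa [val] using h3

theorem PT.addStep : PT (fun p : (List Bool × List Bool × Bool × List Bool) × Bool =>
    addStep p.1 p.2) :=
  (show PT (fun p : (List Bool × List Bool × Bool × List Bool) × Bool =>
    (p.1.1.tail, p.1.2.1.tail, ((p.1.1.headD false && p.1.2.1.headD false) ||
      (p.1.2.2.1 && (p.1.1.headD false || p.1.2.1.headD false))),
      ((!((!(p.1.1.headD false == p.1.2.1.headD false)) == p.1.2.2.1)) :: p.1.2.2.2))) by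
    fun_prop).of_eq fun p => by
    simp only [TwoWayGraded.addStep]
    cases p.1.1.headD false <;> cases p.1.2.1.headD false <;> cases p.1.2.2.1 <;> rfl

theorem sz_addStep_le (s) (b : Bool) : sz (addStep s b) ≤ sz s + 7 := by
  obtain ⟨x, y, c, o⟩ := s
  have h : ∀ l : List Bool, sz l.tail ≤ sz l := fun l => by cases l <;> simp
  have h1 := h x
  have h2 := h y
  simp only [addStep, sz_pair, sz_cons]
  have h3 := sz_bool_le ((x.headD false && y.headD false) || (c && (x.headD false || y.headD false)))
  have h4 := sz_bool_le ((x.headD false ^^ y.headD false) ^^ c)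
  omega

theorem PT.addSucc : PT (fun p : List Bool × List Bool => addSucc p.1 p.2) := by
  have h1 : PT (fun p : List Bool × List Bool => p.1.foldl TwoWayGraded.addStep (p.1, p.2, true, [])) := by
    refine PT.foldl_add (f := fun p : List Bool × List Bool => p.1)
      (h := fun _ => TwoWayGraded.addStep) 7 ?_ (by fun_prop) (by fun_prop) ?_
    · intro a s b _
      simpa using sz_addStep_le s b
    · exact PT.addStep.comp PT.snd
  have h2 : PT (fun p : List Bool × List Bool => p.2.foldl TwoWayGraded.addStep
      (p.1.foldl TwoWayGraded.addStep (p.1, p.2, true, []))) := by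
    refine PT.foldl_add (f := fun p : List Bool × List Bool => p.2)
      (h := fun _ => TwoWayGraded.addStep) 7 ?_ (by fun_prop) (by fun_prop) ?_
    · intro a s b _
      simpa using sz_addStep_le s b
    · exact PT.addStep.comp PT.snd
  unfold TwoWayGraded.addSucc
  fun_prop

theorem length_addSucc (a b : List Bool) : (addSucc a b).length = a.length + b.length + 1 := by
  have h : ∀ (l : List Bool) s, (l.foldl addStep s).2.2.2.length = l.length + s.2.2.2.length := by
    intro l
    induction l with
    | nil => simp
    | cons b l ih => intro s; simp [ih, addStep]; omega
  simp [addSucc, h]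
  omega

/-- Comparison of binary numbers: the state consists of the digits of the second number not yet
read and of the result of the comparison of the parts read. -/
def leStep (s : List Bool × Bool) (x : Bool) : List Bool × Bool :=
  (s.1.tail, bif x == s.1.headD false then s.2 else s.1.headD false)

/-- Comparison of binary numbers. -/
def leBits (a b : List Bool) : Bool :=
  (a.foldl leStep (b, true)).2 || (a.foldl leStep (b, true)).1.any fun x => x

theorem leBits_iff (a b : List Bool) : leBits a b = true ↔ val a ≤ val b := by
  -- Digits come least significant first, so a later difference overrides earlier ones. The flag
  -- decides ties: it separates `≤` from `<`.
  have key : ∀ (a b : List Bool) (r : Bool), (((a.foldl leStep (b, r)).2 ||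
      (a.foldl leStep (b, r)).1.any fun x => x) = true) ↔
      if r = true then val a ≤ val b else val a < val b := by
    intro a
    induction a with
    | nil =>
      intro b r
      have h : (b.any fun x => x) = true ↔ 0 < val b := by
        induction b with
        | nil => simp [val]
        | cons c b ih => cases c <;> simp_all [val]
      cases r <;> simp [h, val]
    | cons x a ih =>
      intro b r
      rw [List.foldl_cons, leStep, ih, ← val_tail b]
      simp only [val]
      cases x <;> cases b.headD false <;> cases r <;> simp <;> omega
  have h := key a b true
  rw [if_pos rfl] at h
  exact h

theorem PT.leBits : PT (fun p : List Bool × List Bool => leBits p.1 p.2) := by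
  have h1 : PT (fun p : List Bool × List Bool => p.1.foldl leStep (p.2, true)) := by
    refine PT.foldl_add (f := fun p : List Bool × List Bool => p.1)
      (h := fun _ => leStep) 3 ?_ (by fun_prop) (by fun_prop) (by unfold leStep; fun_prop)
    rintro - ⟨l, r⟩ b -
    have h1 := sz_bool_le (leStep (l, r) b).2
    have h2 : sz l.tail ≤ sz l := by cases l <;> simp
    simp only [leStep, sz_pair, eval_ofNat] at *
    omega
  unfold TwoWayGraded.leBits
  fun_prop

end TwoWayGraded

namespace TwoWayGraded

open Prog Polynomial

/-! ### The verifier -/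

/-- Entries of certificates: an entry stands for a number of worlds satisfying the same variables.
It records whether the worlds have predecessors, the binary expansion of their number minus one,
and the binary expansions of the indices of the variables they satisfy. -/
abbrev Entry : Type := Bool × List Bool × List (List Bool)

/-- The left subtree. -/
def Tree.left : Tree → Tree
  | .nil => .nil
  | .cons a _ => a

/-- The right subtree. -/
def Tree.right : Tree → Tree
  | .nil => .nil
  | .cons _ b => b

/-- The list represented by a right comb. -/
def Tree.toList : Tree → List Tree
  | .nil => []
  | .cons a b => a :: b.toList

/-- The truth value represented by a tree. -/
def Tree.toBool : Tree → Bool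
  | .nil => false
  | .cons _ _ => true

/-- The word represented by a tree. -/
def Tree.toBits (d : Tree) : List Bool := d.toList.map Tree.toBool

/-- The entry represented by a tree. -/
def Tree.toEntry (d : Tree) : Entry :=
  (d.left.toBool, d.right.left.toBits, d.right.right.toList.map Tree.toBits)

/-- The list of entries represented by a tree. -/
def Tree.toEntries (d : Tree) : List Entry := d.toList.map Tree.toEntry

theorem enc_toList (d : Tree) : Enc.enc d.toList = d := by
  induction d with
  | nil => rfl
  | cons a b _ ih => rw [Tree.toList, enc_cons, ih, enc_tree]

theorem toList_enc {α : Type} [Enc α] (l : List α) : (Enc.enc l).toList = l.map Enc.enc := by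
  induction l with
  | nil => rfl
  | cons a l ih => rw [enc_cons, Tree.toList, ih, List.map_cons]

theorem toBool_enc (b : Bool) : (Enc.enc b).toBool = b := by cases b <;> rfl

theorem toBits_enc (l : List Bool) : (Enc.enc l).toBits = l := by
  rw [Tree.toBits, toList_enc, List.map_map]
  exact (List.map_congr_left fun b _ => toBool_enc b).trans (List.map_id _)

theorem toEntries_enc (L : List Entry) : (Enc.enc L).toEntries = L := by
  rw [Tree.toEntries, toList_enc, List.map_map]
  refine (List.map_congr_left fun e _ => ?_).trans (List.map_id _)
  obtain ⟨b, m, v⟩ := e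
  have h : (v.map Enc.enc).map Tree.toBits = v := by
    rw [List.map_map]
    exact (List.map_congr_left fun b _ => toBits_enc b).trans (List.map_id _)
  simp only [Function.comp, Tree.toEntry, enc_pair, Tree.left, Tree.right, toBool_enc, toBits_enc,
    toList_enc, h, id]

namespace PT

variable {α β γ δ : Type} [Enc α] [Enc β] [Enc γ] [Enc δ]

@[fun_prop]
theorem left {f : α → Tree} (hf : PT f) : PT (fun a => (f a).left) :=
  comp (g := Tree.left) (cases Tree.nil (fst (α := Tree) (β := Tree)) (by
    rintro (_ | ⟨a, b⟩)
    · exact Or.inl ⟨rfl, rfl⟩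
    · exact Or.inr ⟨_, _, rfl, rfl⟩)) hf

@[fun_prop]
theorem right {f : α → Tree} (hf : PT f) : PT (fun a => (f a).right) :=
  comp (g := Tree.right) (cases Tree.nil (snd (α := Tree) (β := Tree)) (by
    rintro (_ | ⟨a, b⟩)
    · exact Or.inl ⟨rfl, rfl⟩
    · exact Or.inr ⟨_, _, rfl, rfl⟩)) hf

@[fun_prop]
theorem toBool {f : α → Tree} (hf : PT f) : PT (fun a => (f a).toBool) :=
  comp (g := Tree.toBool) (cases false (const (α := Tree × Tree) true) (by
    rintro (_ | ⟨a, b⟩)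
    · exact Or.inl ⟨rfl, rfl⟩
    · exact Or.inr ⟨_, _, rfl, rfl⟩)) hf

-- A tree is also its own code when regarded as a list of trees, so this conversion does nothing on
-- codes.
@[fun_prop]
theorem toList {f : α → Tree} (hf : PT f) : PT (fun a => (f a).toList) :=
  comp (g := Tree.toList) (PT.id.of_enc Tree.toList (fun d => (enc_toList d).symm)
    (fun _ => rfl)) hf

@[fun_prop]
theorem treeCons {f g : α → Tree} (hf : PT f) (hg : PT g) : PT (fun a => (f a).cons (g a)) :=
  (pair hf hg).of_enc (fun a => a) (fun _ => rfl) (fun _ => rfl)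

theorem toEntries : PT Tree.toEntries := by
  unfold Tree.toEntries Tree.toEntry Tree.toBits
  fun_prop

end PT

/-- One step of reading a tree from the reversed input. -/
def treeStep (t : Tok) (s : List Tree) : List Tree :=
  match t with
  | .inl _ => s
  | .inr false => .nil :: s
  | .inr true => .cons (s.headD .nil) (s.tail.headD .nil) :: s.tail.tail

/-- The tree read from the reversed input. -/
def readTree (l : List Tok) : Tree := (l.foldl (fun s t => treeStep t s) []).headD .nil

/-- Reading prefix notation backwards, both subtrees of a node lie on top of the stack when the node
is met; formula symbols are ignored. -/
theorem readTree_reverse (x : List Symb) (d : Tree) :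
    readTree (x.map Sum.inl ++ d.ser.map Sum.inr).reverse = d := by
  have h1 : ∀ s, (d.ser.map Sum.inr).foldr treeStep s = d :: s := by
    induction d with
    | nil => intro s; rfl
    | cons a b iha ihb => intro s; simp [Tree.ser, iha, ihb, treeStep]
  have h2 : ∀ s, (x.map Sum.inl).foldr treeStep s = s := by
    induction x with
    | nil => intro s; rfl
    | cons a x ih => intro s; simp [ih, treeStep]
  rw [readTree, List.foldl_reverse, List.foldr_append, h1, h2]
  rfl

theorem PT.readTree : PT readTree := by
  have h1 : PT (fun l : List Tok => l.foldl (fun s t => treeStep t s) []) := by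
    refine PT.foldl_add (f := fun l : List Tok => l) (h := fun _ s t => treeStep t s) 4 ?_
      (by fun_prop) (by fun_prop) ?_
    · intro _ s t _
      rw [eval_ofNat]
      rcases t with t | (_ | _)
      · simp [treeStep]
      · simp only [treeStep, sz_cons]
        simp only [sz, enc_tree, Tree.size_nil]
        omega
      · rcases s with _ | ⟨a, _ | ⟨b, s⟩⟩ <;> simp [treeStep] <;> simp [sz, enc_tree] <;> omega
    · refine (PT.tokCases (h := treeStep) ?_).comp (PT.snd (α := List Tok))
      rintro (t | (_ | _)) <;> unfold treeStep <;> fun_prop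
  unfold TwoWayGraded.readTree
  fun_prop

/-- Binary expansions of natural numbers do not end with a zero. -/
def canon (l : List Bool) : Bool := l.foldl (fun _ b => b) true

@[fun_prop]
theorem PT.canon {α : Type} [Enc α] {f : α → List Bool} (hf : PT f) : PT (fun a => canon (f a)) := by
  have h : PT TwoWayGraded.canon := by
    refine PT.foldl_add (f := fun l : List Bool => l) (h := fun _ _ b => b) 3 ?_
      (by fun_prop) (by fun_prop) (by fun_prop)
    intro _ s b _
    have := sz_bool_le b
    rw [eval_ofNat]
    omega
  exact h.comp hf

/-- The binary expansion of the number of worlds of the entries (with predecessors, unless `all`)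
selected by a vector of truth values. -/
def total (all : Bool) (L : List Entry) (v : List Bool) : List Bool :=
  (L.zip v).foldl (fun acc p => bif p.2 && (all || p.1.1) then addSucc acc p.1.2.1 else acc) []

theorem sz_bits_le (l : List Bool) : sz l ≤ 4 * l.length + 1 := by
  induction l with
  | nil => simp
  | cons b l ih =>
    have := sz_bool_le b
    simp
    omega

attribute [fun_prop] PT.addSucc PT.leBits PT.toEntries PT.readTree

-- The accumulator is bounded through its number of digits, which `addSucc` makes additive. The code
-- size of a word depends on the digits themselves, so its growth in one step is not bounded as
-- `PT.foldl_add` would need.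
@[fun_prop]
theorem PT.total (all : Bool) : PT (fun p : List Entry × List Bool => total all p.1 p.2) := by
  have h : PT (fun l : List (Entry × Bool) =>
      l.foldl (fun acc p => bif p.2 && (all || p.1.1) then TwoWayGraded.addSucc acc p.1.2.1 else acc) []) := by
    refine PT.foldl (f := fun l : List (Entry × Bool) => l) (h := fun _ acc p =>
      bif p.2 && (all || p.1.1) then TwoWayGraded.addSucc acc p.1.2.1 else acc) (by fun_prop) (by fun_prop)
      (by fun_prop) (4 * X + 1) ?_
    rintro _ l ⟨l', rfl⟩
    have key : ∀ (l : List (Entry × Bool)) (acc : List Bool), (l.foldl (fun acc p =>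
        bif p.2 && (all || p.1.1) then TwoWayGraded.addSucc acc p.1.2.1 else acc) acc).length ≤
        acc.length + sz l := by
      intro l
      induction l with
      | nil => simp
      | cons p l ih =>
        intro acc
        rw [List.foldl_cons]
        refine (ih _).trans ?_
        obtain ⟨⟨b, m, v⟩, c⟩ := p
        have := length_le_sz m
        cases (c && (all || b)) <;> simp [length_addSucc]; omega
    have h1 := key l []
    have h2 := sz_le_sz_append l l'
    refine (sz_bits_le _).trans ?_
    simp only [List.length_nil, eval_add, eval_mul, eval_ofNat, eval_X, eval_one] at h1 ⊢
    omega
  unfold TwoWayGraded.total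
  exact h.comp (f := fun p : List Entry × List Bool => p.1.zip p.2) (by fun_prop)

/-- The states of the evaluation of a formula read from right to left: a flag for the absence of
syntax errors, the numeral being read, and the vectors of truth values (indexed by the entries)
of the formulas read. -/
abbrev EvalState : Type := Bool × List Bool × List (List Bool)

/-- The state after a syntax error. -/
def failState : EvalState := (false, [], [])

/-- Applies a binary operation to vectors. -/
def vec2 (L : List Entry) (f : Bool → Bool → Bool) (v w : List Bool) : List Bool :=
  (L.zip (v.zip w)).map fun p => f p.2.1 p.2.2

/-- The effect of a binary connective. -/
def binStep (L : List Entry) (f : Bool → Bool → Bool) (s : EvalState) : EvalState :=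
  bif s.1 && (s.2.1.isEmpty && (!s.2.2.isEmpty && !s.2.2.tail.isEmpty)) then
    (true, [], vec2 L f (s.2.2.headD []) (s.2.2.tail.headD []) :: s.2.2.tail.tail)
  else failState

/-- One step of the evaluation. -/
def evalStep (t : Tok) (L : List Entry) (s : EvalState) : EvalState :=
  match t with
  | .inr _ => s
  | .inl (.bit b) => bif s.1 then (true, b :: s.2.1, s.2.2) else failState
  | .inl .var => bif s.1 && canon s.2.1 then
      (true, [], (L.map fun e => e.2.2.any fun w => w == s.2.1) :: s.2.2) else failState
  | .inl .top => bif s.1 && s.2.1.isEmpty then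
      (true, [], (L.map fun _ => true) :: s.2.2) else failState
  | .inl .bot => bif s.1 && s.2.1.isEmpty then
      (true, [], (L.map fun _ => false) :: s.2.2) else failState
  | .inl .neg => bif s.1 && (s.2.1.isEmpty && !s.2.2.isEmpty) then
      (true, [], ((L.zip (s.2.2.headD [])).map fun p => !p.2) :: s.2.2.tail) else failState
  | .inl .and => binStep L (fun a b => a && b) s
  | .inl .or => binStep L (fun a b => a || b) s
  | .inl .imp => binStep L (fun a b => !a || b) s
  | .inl .iff => binStep L (fun a b => a == b) s
  | .inl .dia => bif s.1 && (canon s.2.1 && !s.2.2.isEmpty) then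
      (true, [], (L.map fun _ => leBits s.2.1 (total false L (s.2.2.headD []))) :: s.2.2.tail)
      else failState
  | .inl .revDia => bif s.1 && (canon s.2.1 && !s.2.2.isEmpty) then
      (true, [], (L.map fun e => leBits s.2.1 (bif e.1 then total true L (s.2.2.headD []) else [])) ::
        s.2.2.tail) else failState

/-- The state after the evaluation of the formula in the reversed input. -/
def evalState (L : List Entry) (l : List Tok) : EvalState :=
  l.foldl (fun s t => evalStep t L s) (true, [], [])

/-- The criterion for acceptance. -/
def accepts (glob serial : Bool) (L : List Entry) (s : EvalState) : Bool :=
  s.1 && (s.2.1.isEmpty && (!s.2.2.isEmpty && (s.2.2.tail.isEmpty &&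
    ((bif glob then !(s.2.2.headD []).isEmpty && (s.2.2.headD []).all fun b => b
      else (s.2.2.headD []).any fun b => b) && (!serial || L.any fun e => e.1)))))

/-- The verifier on the reversed input. -/
def verifier (glob serial : Bool) (l : List Tok) : Bool :=
  accepts glob serial (readTree l).toEntries (evalState (readTree l).toEntries l)

/-- Each step pushes at most one digit or one vector, and every new vector arises by mapping over
`L` or zipping with it, so its length is at most that of `L`. -/
theorem sz_evalStep_le (t : Tok) (L : List Entry) (s : EvalState) :
    sz (evalStep t L s) ≤ sz s + (4 * sz L + 20) := by
  obtain ⟨ok, bits, st⟩ := s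
  have hok := sz_bool_le
  have hfail : sz failState ≤ sz (ok, bits, st) + (4 * sz L + 20) := by
    simp [failState]
    have := hok false
    omega
  have hL := length_le_sz L
  have hpush : ∀ (v : List Bool) (st' : List (List Bool)), v.length ≤ L.length → sz st' ≤ sz st →
      sz ((true, [], v :: st') : EvalState) ≤ sz (ok, bits, st) + (4 * sz L + 20) := by
    intro v st' hv hst
    have h1 := sz_bits_le v
    have h2 := hok true
    have h3 := sz_pos ok
    have h4 := sz_pos bits
    simp
    omega
  have htail : ∀ l : List (List Bool), sz l.tail ≤ sz l := fun l => by cases l <;> simp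
  have htail2 := (htail st.tail).trans (htail st)
  have hcond : ∀ (c : Bool) (s' : EvalState), sz s' ≤ sz (ok, bits, st) + (4 * sz L + 20) →
      sz (bif c then s' else failState) ≤ sz (ok, bits, st) + (4 * sz L + 20) := by
    intro c s' h
    cases c
    · exact hfail
    · exact h
  have hbin : ∀ f, sz (binStep L f (ok, bits, st)) ≤ sz (ok, bits, st) + (4 * sz L + 20) := by
    intro f
    exact hcond _ _ (hpush _ _ (by simp [vec2]) htail2)
  rcases t with t | b
  · cases t with
    | bit b =>
      refine hcond _ _ ?_
      have h1 := hok true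
      have h2 := hok b
      have h3 := sz_pos ok
      simp
      omega
    | var => exact hcond _ _ (hpush _ _ (by simp) le_rfl)
    | top => exact hcond _ _ (hpush _ _ (by simp) le_rfl)
    | bot => exact hcond _ _ (hpush _ _ (by simp) le_rfl)
    | neg => exact hcond _ _ (hpush _ _ (by simp) (htail _))
    | and => exact hbin _
    | or => exact hbin _
    | imp => exact hbin _
    | iff => exact hbin _
    | dia => exact hcond _ _ (hpush _ _ (by simp) (htail _))
    | revDia => exact hcond _ _ (hpush _ _ (by simp) (htail _))
  · exact Nat.le_add_right _ _

theorem PT.binStep {f : Bool → Bool → Bool} (hf : PT (fun p : Bool × Bool => f p.1 p.2)) :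
    PT (fun p : List Entry × EvalState => binStep p.1 f p.2) := by
  unfold TwoWayGraded.binStep vec2
  fun_prop

theorem PT.evalStep (t : Tok) : PT (fun p : List Entry × EvalState => evalStep t p.1 p.2) := by
  rcases t with t | b
  · cases t with
    | and | or | imp | iff => exact PT.binStep (by fun_prop)
    | bit b => unfold TwoWayGraded.evalStep; fun_prop
    | var => unfold TwoWayGraded.evalStep; fun_prop
    | top => unfold TwoWayGraded.evalStep; fun_prop
    | bot => unfold TwoWayGraded.evalStep; fun_prop
    | neg => unfold TwoWayGraded.evalStep; fun_prop
    | dia => unfold TwoWayGraded.evalStep; fun_prop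
    | revDia => unfold TwoWayGraded.evalStep; fun_prop
  · exact PT.snd

@[fun_prop]
theorem PT.evalState : PT (fun p : List Entry × List Tok => evalState p.1 p.2) := by
  unfold TwoWayGraded.evalState
  refine PT.foldl_add (f := fun p : List Entry × List Tok => p.2)
    (h := fun p s t => TwoWayGraded.evalStep t p.1 s) (4 * X + 20) ?_ (by fun_prop) (by fun_prop) ?_
  · rintro ⟨L, l⟩ s t -
    have := sz_evalStep_le t L s
    simp
    omega
  · exact (PT.tokCases (h := fun t (p : List Entry × EvalState) =>
      TwoWayGraded.evalStep t p.1 p.2) PT.evalStep).comp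
      (f := fun p : (List Entry × List Tok) × EvalState × Tok => ((p.1.1, p.2.1), p.2.2))
      (by fun_prop)

theorem PT.verifier (glob serial : Bool) : PT (verifier glob serial) := by
  unfold TwoWayGraded.verifier accepts
  fun_prop

end TwoWayGraded

namespace TwoWayGraded

/-! ### Correctness of the evaluation -/

theorem val_encodeNat (n : ℕ) : val (Computability.encodeNat n) = n := by
  have h : ∀ p : PosNum, val (Computability.encodePosNum p) = p := by
    intro p
    induction p with
    | one => rfl
    | bit0 p ih => simp [Computability.encodePosNum, val, ih]; omega
    | bit1 p ih => simp [Computability.encodePosNum, val, ih]; omega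
  conv_rhs => rw [← Num.to_of_nat n]
  rw [Computability.encodeNat]
  cases (n : Num) with
  | zero => rfl
  | pos p => exact h p

theorem canon_encodeNat (n : ℕ) : canon (Computability.encodeNat n) = true := by
  have h : ∀ (p : PosNum) b, (Computability.encodePosNum p).foldl (fun _ b => b) b = true := by
    intro p
    induction p with
    | one => intro b; rfl
    | bit0 p ih => intro b; exact ih _
    | bit1 p ih => intro b; exact ih _
  rw [Computability.encodeNat]
  cases (n : Num) with
  | zero => rfl
  | pos p => exact h p _

/-- A nonempty word ending in `true` is built from the numeral of one by prepending digits, which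
are the constructors of `PosNum`; the empty word is the numeral of zero. This lets the parser reject
noncanonical numerals. -/
theorem encodeNat_val {l : List Bool} (h : canon l = true) : Computability.encodeNat (val l) = l := by
  have key : ∀ (l : List Bool) b, (b :: l).foldl (fun _ b => b) true = true →
      ∃ p : PosNum, Computability.encodePosNum p = b :: l := by
    intro l
    induction l with
    | nil =>
      intro b hb
      obtain rfl : b = true := hb
      exact ⟨.one, rfl⟩
    | cons c l ih =>
      intro b hb
      obtain ⟨p, hp⟩ := ih c hb
      cases b with
      | true => exact ⟨.bit1 p, by rw [Computability.encodePosNum, hp]⟩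
      | false => exact ⟨.bit0 p, by rw [Computability.encodePosNum, hp]⟩
  have hn : ∃ n, Computability.encodeNat n = l := by
    cases l with
    | nil => exact ⟨0, rfl⟩
    | cons b l =>
      obtain ⟨p, hp⟩ := key l b h
      refine ⟨p, ?_⟩
      have h2 : ((p : ℕ) : Num) = Num.pos p := by
        simp
      rw [Computability.encodeNat, h2, Computability.encodeNum, hp]
  obtain ⟨n, rfl⟩ := hn
  rw [val_encodeNat]

/-- The number of worlds an entry stands for. -/
def weight (e : Entry) : ℕ := val e.2.1 + 1

open Classical in
/-- Truth of a formula at the worlds of an entry. -/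
noncomputable def esat (L : List Entry) : Formula → Entry → Bool
  | .var i, e => e.2.2.any fun w => w == Computability.encodeNat i
  | .top, _ => true
  | .bot, _ => false
  | .neg φ, e => !(esat L φ e)
  | .and φ ψ, e => esat L φ e && esat L ψ e
  | .or φ ψ, e => esat L φ e || esat L ψ e
  | .imp φ ψ, e => !(esat L φ e) || esat L ψ e
  | .iff φ ψ, e => esat L φ e == esat L ψ e
  | .dia n φ, _ => decide (n ≤ (L.map fun e => if (esat L φ e && e.1) = true then weight e else 0).sum)
  | .revDia n φ, e => decide (n ≤ if e.1 = true then
      (L.map fun e => if esat L φ e = true then weight e else 0).sum else 0)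

theorem zip_map_self {α β : Type} (L : List α) (f : α → β) : L.zip (L.map f) = L.map fun a => (a, f a) := by
  induction L with
  | nil => rfl
  | cons a L ih => simp [ih]

theorem val_total (all : Bool) (L : List Entry) (f : Entry → Bool) :
    val (total all L (L.map f)) =
      (L.map fun e => if (f e && (all || e.1)) = true then weight e else 0).sum := by
  have key : ∀ (L : List Entry) acc, val ((L.map fun e => (e, f e)).foldl (fun acc p =>
      bif p.2 && (all || p.1.1) then addSucc acc p.1.2.1 else acc) acc) =
      val acc + (L.map fun e => if (f e && (all || e.1)) = true then weight e else 0).sum := by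
    intro L
    induction L with
    | nil => simp
    | cons e L ih =>
      intro acc
      rw [List.map_cons, List.foldl_cons, ih]
      cases h : (f e && (all || e.1)) with
      | false =>
        simp only [h, cond_false, List.map_cons, List.sum_cons, Bool.false_eq_true, if_false,
          zero_add]
      | true =>
        simp only [h, cond_true, List.map_cons, List.sum_cons, if_true, val_addSucc, weight]
        ring
  rw [total, zip_map_self, key]
  simp [val]

/-! ### Parsing, and its simulation by the evaluation. -/

/-- One step of parsing from right to left. The state consists of the numeral being read and the
formulas read. -/
def parseStep (t : Symb) (s : Option (List Bool × List Formula)) :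
    Option (List Bool × List Formula) :=
  match t, s with
  | _, none => none
  | .bit b, some (w, l) => some (b :: w, l)
  | .var, some (w, l) => if canon w then some ([], .var (val w) :: l) else none
  | .top, some ([], l) => some ([], .top :: l)
  | .bot, some ([], l) => some ([], .bot :: l)
  | .neg, some ([], φ :: l) => some ([], .neg φ :: l)
  | .and, some ([], φ :: ψ :: l) => some ([], .and φ ψ :: l)
  | .or, some ([], φ :: ψ :: l) => some ([], .or φ ψ :: l)
  | .imp, some ([], φ :: ψ :: l) => some ([], .imp φ ψ :: l)
  | .iff, some ([], φ :: ψ :: l) => some ([], .iff φ ψ :: l)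
  | .dia, some (w, φ :: l) => if canon w then some ([], .dia (val w) φ :: l) else none
  | .revDia, some (w, φ :: l) => if canon w then some ([], .revDia (val w) φ :: l) else none
  | _, _ => none

/-- Parsing from right to left. -/
def parse (x : List Symb) : Option (List Bool × List Formula) :=
  x.foldr parseStep (some ([], []))

theorem parse_encode (φ : Formula) : ∀ l : List Formula,
    φ.encode.foldr parseStep (some ([], l)) = some ([], φ :: l) := by
  have hnum : ∀ (n : ℕ) (l : List Formula), (numeral n).foldr parseStep (some ([], l)) =
      some (Computability.encodeNat n, l) := by
    intro n l
    rw [numeral]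
    generalize Computability.encodeNat n = w
    induction w with
    | nil => rfl
    | cons b w ih => rw [List.map_cons, List.foldr_cons, ih]; rfl
  induction φ with
  | var i => intro l; simp [Formula.encode, hnum, parseStep, canon_encodeNat, val_encodeNat]
  | top | bot => intro l; simp [Formula.encode, parseStep]
  | neg φ ih => intro l; simp [Formula.encode, ih, parseStep]
  | and φ ψ ih1 ih2 | or φ ψ ih1 ih2 | imp φ ψ ih1 ih2 | iff φ ψ ih1 ih2 =>
    intro l
    simp [Formula.encode, ih1, ih2, parseStep]
  | dia n φ ih | revDia n φ ih =>
    intro l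
    simp [Formula.encode, ih, hnum, parseStep, canon_encodeNat, val_encodeNat]

/-- The invariant of the parser: the suffix read consists of the pending numeral followed by the
codes of the formulas on the stack. Canonicity is needed to recover the digits from the number. -/
theorem encode_of_parse (x : List Symb) : ∀ w l, parse x = some (w, l) →
    x = w.map Symb.bit ++ (l.map Formula.encode).flatten := by
  induction x with
  | nil =>
    intro w l h
    simp only [parse, List.foldr_nil, Option.some.injEq, Prod.mk.injEq] at h
    obtain ⟨rfl, rfl⟩ := h
    rfl
  | cons t x ih =>
    intro w l h
    rw [parse, List.foldr_cons, ← parse] at h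
    cases hx : parse x with
    | none => rw [hx] at h; cases t <;> simp [parseStep] at h
    | some p =>
      obtain ⟨w', l'⟩ := p
      have hxe := ih _ _ hx
      rw [hx] at h
      have hnum : ∀ w, canon w = true → numeral (val w) = w.map Symb.bit := fun w hw => by
        rw [numeral, encodeNat_val hw]
      cases t <;> rcases w' with _ | ⟨b, w'⟩ <;> rcases l' with _ | ⟨φ, _ | ⟨ψ, l'⟩⟩ <;>
        simp only [parseStep, Option.some.injEq, Prod.mk.injEq, reduceCtorEq,
          Option.ite_none_right_eq_some] at h <;>
        first
        | (obtain ⟨rfl, rfl⟩ := h; simp [hxe, Formula.encode])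
        | (obtain ⟨hc, rfl, rfl⟩ := h; simp [hxe, Formula.encode, hnum _ hc])

/-- The evaluation state that corresponds to a state of the parser. -/
noncomputable def stateOf (L : List Entry) : Option (List Bool × List Formula) → EvalState
  | none => failState
  | some (w, l) => (true, w, l.map fun φ => L.map (esat L φ))

theorem vec2_map (L : List Entry) (f : Bool → Bool → Bool) (g h : Entry → Bool) :
    vec2 L f (L.map g) (L.map h) = L.map fun e => f (g e) (h e) := by
  rw [vec2, List.zip_map', zip_map_self, List.map_map]
  rfl

theorem neg_map (L : List Entry) (g : Entry → Bool) :
    (L.zip (L.map g)).map (fun p => !p.2) = L.map fun e => !(g e) := by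
  rw [zip_map_self, List.map_map]
  rfl

/-- The evaluator follows the parser, with each formula on the stack replaced by its truth vector.
-/
theorem evalStep_stateOf (L : List Entry) (t : Symb) (s : Option (List Bool × List Formula)) :
    evalStep (.inl t) L (stateOf L s) = stateOf L (parseStep t s) := by
  have hf : ∀ t, evalStep (.inl t) L failState = failState := by
    intro t; cases t <;> rfl
  rcases s with _ | ⟨w, l⟩
  · cases t <;> exact hf _
  have hcanon : ∀ w, canon w = true → Computability.encodeNat (val w) = w := fun w => encodeNat_val
  cases t with
  | bit b => rfl
  | var =>
    cases hw : canon w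
    · simp [evalStep, stateOf, parseStep, hw]
    · simp [evalStep, stateOf, parseStep, hw, esat, hcanon w hw]
  | top | bot => cases w <;> simp [evalStep, stateOf, parseStep, esat]
  | neg =>
    cases w <;> cases l <;> simp [evalStep, stateOf, parseStep, esat, neg_map]
  | and | or | imp | iff =>
    cases w <;> rcases l with _ | ⟨φ, _ | ⟨ψ, l⟩⟩ <;>
      simp [evalStep, stateOf, parseStep, esat, binStep, vec2_map]
  | dia =>
    have key : ∀ g : Entry → Bool, leBits w (total false L (L.map g)) =
        decide (val w ≤ (L.map fun e => if (g e && e.1) = true then weight e else 0).sum) := by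
      intro g
      rw [Bool.eq_iff_iff, leBits_iff, val_total, decide_eq_true_iff]
      rfl
    cases hw : canon w <;> cases l <;> simp [evalStep, stateOf, parseStep, hw]
    rw [key]
    simp [esat]
  | revDia =>
    have key : ∀ (g : Entry → Bool) (b : Bool),
        leBits w (bif b then total true L (L.map g) else []) = decide (val w ≤ if b = true then
          (L.map fun e => if g e = true then weight e else 0).sum else 0) := by
      intro g b
      rw [Bool.eq_iff_iff, leBits_iff, decide_eq_true_iff]
      cases b
      · rfl
      · simp [val_total]
    cases hw : canon w <;> cases l <;> simp [evalStep, stateOf, parseStep, hw, -Prod.forall]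
    rintro e -
    rw [key]
    simp [esat]

theorem evalState_eq (L : List Entry) (x : List Symb) (y : List Bool) :
    evalState L (x.map Sum.inl ++ y.map Sum.inr).reverse = stateOf L (parse x) := by
  have h1 : ∀ s, (y.map Sum.inr).foldr (fun t s => evalStep t L s) s = s := by
    induction y with
    | nil => intro s; rfl
    | cons a y ih => intro s; rw [List.map_cons, List.foldr_cons, ih]; rfl
  rw [evalState, List.foldl_reverse, List.foldr_append, h1]
  induction x with
  | nil => rfl
  | cons t x ih => rw [List.map_cons, List.foldr_cons, ih, evalStep_stateOf]; rfl

/-- Acceptance in terms of the entries. -/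
def Accepts (glob serial : Bool) (L : List Entry) (φ : Formula) : Prop :=
  (if glob = true then L ≠ [] ∧ ∀ e ∈ L, esat L φ e = true else ∃ e ∈ L, esat L φ e = true) ∧
    (serial = true → ∃ e ∈ L, e.1 = true)

/-- Acceptance requires an empty numeral and a single vector on the stack, that is, that the parser
has read the whole word as one formula. -/
theorem verifier_iff (glob serial : Bool) (x : List Symb) (y : List Bool) :
    verifier glob serial (x.map Sum.inl ++ y.map Sum.inr).reverse = true ↔
      ∃ φ : Formula, φ.encode = x ∧
        Accepts glob serial (readTree (x.map Sum.inl ++ y.map Sum.inr).reverse).toEntries φ := by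
  rw [verifier, evalState_eq]
  generalize (readTree (x.map Sum.inl ++ y.map Sum.inr).reverse).toEntries = L
  constructor
  · intro h
    cases hp : parse x with
    | none => rw [hp] at h; simp [accepts, stateOf, failState] at h
    | some p =>
      obtain ⟨w, l⟩ := p
      rw [hp] at h
      have hx := encode_of_parse x w l hp
      rcases w with _ | ⟨b, w⟩
      · rcases l with _ | ⟨φ, _ | ⟨ψ, l⟩⟩
        · simp [accepts, stateOf] at h
        · refine ⟨φ, by simp [hx], ?_⟩
          cases glob <;> cases serial <;> simpa [accepts, stateOf, Accepts] using h
        · simp [accepts, stateOf] at h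
      · simp [accepts, stateOf] at h
  · rintro ⟨φ, rfl, h⟩
    rw [parse, parse_encode]
    cases glob <;> cases serial <;> simpa [accepts, stateOf, Accepts] using h

end TwoWayGraded

namespace TwoWayGraded

/-! ### Soundness -/

/-- Satisfiability in a (serial) transitive Euclidean frame at all worlds or at some world. -/
def Satisfiable (glob serial : Bool) (φ : Formula) : Prop :=
  ∃ A : KripkeStructure.{u}, (K45 A.World A.R ∧ (serial = true → ∀ x, ∃ y, A.R x y)) ∧
    if glob = true then ∀ w, A.Sat w φ else ∃ w, A.Sat w φ

/-- The Kripke structure described by a list of entries. -/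
def ofEntries (L : List Entry) (h : L ≠ []) : KripkeStructure.{u} where
  World := ULift.{u} (Σ i : Fin L.length, Fin (weight L[i]))
  nonempty := ⟨⟨⟨⟨0, List.length_pos_iff.2 h⟩, ⟨0, Nat.succ_pos _⟩⟩⟩⟩
  R _ v := L[v.down.1].1 = true
  V i := {w | esat L (.var i) L[w.down.1] = true}

/-- The worlds form disjoint blocks of size `weight`, and a predicate on entries selects whole
blocks. -/
theorem encard_sigma_entries (L : List Entry) (p : Entry → Bool) :
    {v : ULift.{u} (Σ i : Fin L.length, Fin (weight L[i])) | p L[v.down.1] = true}.encard =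
      ((L.map fun e => if p e = true then weight e else 0).sum : ℕ) := by
  have h1 : {v : ULift.{u} (Σ i : Fin L.length, Fin (weight L[i])) | p L[v.down.1] = true} =
      (((Finset.univ.sigma fun i : Fin L.length =>
        if p L[i] = true then (Finset.univ : Finset (Fin (weight L[i]))) else ∅).map
          Equiv.ulift.{u}.symm.toEmbedding : Finset _) : Set _) := by
    ext ⟨i, j⟩
    simp only [Set.mem_ofPred_eq, Finset.coe_map, Equiv.coe_toEmbedding, Set.mem_image,
      Finset.mem_coe, Finset.mem_sigma, Finset.mem_univ, true_and]
    constructor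
    · intro hp
      exact ⟨⟨i, j⟩, by simp only [hp, if_true, Finset.mem_univ], rfl⟩
    · rintro ⟨⟨i', j'⟩, hp, he⟩
      cases he
      by_contra hn
      have hp' : j ∈ if p L[i] = true then (Finset.univ : Finset (Fin (weight L[i]))) else ∅ := hp
      rw [if_neg hn] at hp'
      exact Finset.notMem_empty _ hp'
  rw [h1, Set.encard_coe_eq_coe_finsetCard, Finset.card_map, Finset.card_sigma,
    ← Fin.sum_univ_fun_getElem]
  congr 1
  refine Finset.sum_congr rfl fun i _ => ?_
  split_ifs <;> simp_all

theorem encard_ofEntries (L : List Entry) (h : L ≠ []) (p : Entry → Bool) :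
    {v : (ofEntries.{u} L h).World | p L[v.down.1] = true}.encard =
      ((L.map fun e => if p e = true then weight e else 0).sum : ℕ) :=
  encard_sigma_entries L p

/-- The successors of any world are the flagged worlds. A flagged world has all worlds as
predecessors, an unflagged one has none. -/
theorem sat_ofEntries (L : List Entry) (h : L ≠ []) (φ : Formula) :
    ∀ w : (ofEntries.{u} L h).World, (ofEntries L h).Sat w φ ↔ esat L φ L[w.down.1] = true := by
  induction φ with
  | var i => intro w; rfl
  | top => intro w; simp [KripkeStructure.Sat, esat]
  | bot => intro w; simp [KripkeStructure.Sat, esat]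
  | neg φ ih => intro w; simp [KripkeStructure.Sat, esat, ih]
  | and φ ψ ih1 ih2 => intro w; simp [KripkeStructure.Sat, esat, ih1, ih2]
  | or φ ψ ih1 ih2 => intro w; simp [KripkeStructure.Sat, esat, ih1, ih2]
  | imp φ ψ ih1 ih2 =>
    intro w
    simp only [KripkeStructure.Sat, esat, ih1, ih2]
    cases esat L φ L[w.down.1] <;> simp
  | iff φ ψ ih1 ih2 =>
    intro w
    simp only [KripkeStructure.Sat, esat, ih1, ih2]
    cases esat L φ L[w.down.1] <;> cases esat L ψ L[w.down.1] <;> simp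
  | dia n φ ih =>
    intro w
    have h1 : {v | (ofEntries L h).R w v ∧ (ofEntries L h).Sat v φ} =
        {v : (ofEntries.{u} L h).World | (esat L φ L[v.down.1] && L[v.down.1].1) = true} := by
      ext v
      simp only [Set.mem_ofPred_eq, ih, Bool.and_eq_true]
      exact and_comm
    rw [KripkeStructure.Sat, h1, encard_ofEntries L h fun e => esat L φ e && e.1]
    simp only [esat, decide_eq_true_iff, Nat.cast_le]
  | revDia n φ ih =>
    intro w
    rw [KripkeStructure.Sat]
    simp only [esat, decide_eq_true_iff]
    by_cases hw : L[w.down.1].1 = true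
    · have h1 : {v | (ofEntries L h).R v w ∧ (ofEntries L h).Sat v φ} =
          {v : (ofEntries.{u} L h).World | esat L φ L[v.down.1] = true} := by
        ext v
        simp only [Set.mem_ofPred_eq, ih]
        exact and_iff_right hw
      rw [h1, encard_ofEntries L h (esat L φ), if_pos hw, Nat.cast_le]
    · have h1 : {v | (ofEntries L h).R v w ∧ (ofEntries L h).Sat v φ} = ∅ := by
        ext v
        simp only [Set.mem_ofPred_eq, Set.mem_empty_iff_false, iff_false]
        exact fun h => hw h.1
      rw [h1, if_neg hw]
      simp

theorem satisfiable_of_accepts {glob serial : Bool} {L : List Entry} {φ : Formula}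
    (h : Accepts glob serial L φ) : Satisfiable.{u} glob serial φ := by
  have hL : L ≠ [] := by
    rintro rfl
    cases glob <;> simp [Accepts] at h
  have hworld : ∀ e ∈ L, ∃ w : (ofEntries.{u} L hL).World, L[w.down.1] = e := by
    intro e he
    obtain ⟨i, hi, rfl⟩ := List.getElem_of_mem he
    exact ⟨⟨⟨⟨i, hi⟩, ⟨0, Nat.succ_pos _⟩⟩⟩, rfl⟩
  -- Accessibility depends only on the target, so transitivity and the Euclidean property each
  -- return one of their hypotheses.
  refine ⟨ofEntries L hL, ⟨⟨fun _ _ _ _ h => h, fun _ _ _ _ h => h⟩, fun hs x => ?_⟩, ?_⟩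
  · obtain ⟨e, he, he1⟩ := h.2 hs
    obtain ⟨w, rfl⟩ := hworld e he
    exact ⟨w, he1⟩
  · cases glob with
    | true => exact fun w => (sat_ofEntries L hL φ w).2 (h.1.2 _ (List.getElem_mem _))
    | false =>
      obtain ⟨e, he, he1⟩ := h.1
      obtain ⟨w, rfl⟩ := hworld e he
      exact ⟨w, (sat_ofEntries L hL φ w).2 he1⟩

/-! ### Reducing the number of types -/

/-- A bound on the number of types needed to realize `m` sums. -/
def typeBound (m : ℕ) : ℕ := m * (2 * m + 2) + 1

/-- The pigeonhole inequality: a set of `b` types has `2 ^ b` subsets, while the intersection sizes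
with `m` sets take at most `(b + 1) ^ m` values. -/
theorem lt_two_pow_typeBound (m : ℕ) : (typeBound m + 1) ^ m < 2 ^ typeBound m := by
  have h1 : m * (2 * m + 2) + 2 ≤ 2 ^ (2 * m + 2) := by
    induction m with
    | zero => norm_num
    | succ m ih =>
      have h2 : 2 ^ (2 * (m + 1) + 2) = 4 * 2 ^ (2 * m + 2) := by ring
      rw [h2]
      nlinarith
  calc (typeBound m + 1) ^ m ≤ (2 ^ (2 * m + 2)) ^ m := Nat.pow_le_pow_left h1 m
    _ = 2 ^ (m * (2 * m + 2)) := by rw [← pow_mul, mul_comm]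
    _ < 2 ^ typeBound m := Nat.pow_lt_pow_right (by norm_num) (Nat.lt_succ_self _)

/-- Subtract the minimum of `x` over `P` on all of `P` and add it on `Q`. A set in `F` meets `P` and
`Q` equally often, so its sum is unchanged, and the minimizer drops to zero. Nonvanishing on `Q`
keeps the support from growing. -/
theorem exists_exchange {T : Type*} [DecidableEq T] (F : Finset (Finset T)) (x : T → ℕ)
    (P Q : Finset T) (hPQ : Disjoint P Q) (hP : P.Nonempty) (hx : ∀ τ ∈ Q, x τ ≠ 0)
    (hF : ∀ S ∈ F, (P ∩ S).card = (Q ∩ S).card) :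
    ∃ x' : T → ℕ, (∀ τ, x τ = 0 → x' τ = 0) ∧ (∀ S ∈ F, ∑ τ ∈ S, x' τ = ∑ τ ∈ S, x τ) ∧
      ∃ τ ∈ P, x' τ = 0 := by
  obtain ⟨τ₀, hτ₀, hmin⟩ := P.exists_min_image x hP
  let x' : T → ℕ := fun τ => if τ ∈ P then x τ - x τ₀ else if τ ∈ Q then x τ + x τ₀ else x τ
  have hbal : ∀ τ, x' τ + (if τ ∈ P then x τ₀ else 0) = x τ + (if τ ∈ Q then x τ₀ else 0) := by
    intro τ
    by_cases h1 : τ ∈ P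
    · have h2 : τ ∉ Q := Finset.disjoint_left.1 hPQ h1
      have h3 := hmin τ h1
      simp only [x', h1, h2, if_true, if_false]
      omega
    · by_cases h2 : τ ∈ Q <;> simp [x', h1, h2]
  refine ⟨x', fun τ h => ?_, fun S hS => ?_, τ₀, hτ₀, by simp [x', hτ₀]⟩
  · have h2 : τ ∉ Q := fun h2 => hx τ h2 h
    have h3 := hbal τ
    simp only [h2, if_false, h] at h3
    omega
  · have h1 : ∑ τ ∈ S, (x' τ + (if τ ∈ P then x τ₀ else 0)) =
        ∑ τ ∈ S, (x τ + (if τ ∈ Q then x τ₀ else 0)) := Finset.sum_congr rfl fun τ _ => hbal τ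
    have h2 : ∀ R : Finset T, ∑ τ ∈ S, (if τ ∈ R then x τ₀ else 0) = (R ∩ S).card * x τ₀ := by
      intro R
      rw [← Finset.sum_filter, Finset.sum_const, smul_eq_mul, Finset.inter_comm,
        Finset.filter_mem_eq_inter]
    rw [Finset.sum_add_distrib, Finset.sum_add_distrib, h2, h2, hF S hS] at h1
    exact Nat.add_right_cancel h1

theorem exists_small_support {T : Type*} [DecidableEq T] (U : Finset T) (F : Finset (Finset T)) :
    ∀ (k : ℕ) (x : T → ℕ), (U.filter fun τ => x τ ≠ 0).card = k →
    ∃ x' : T → ℕ, (∀ τ, x τ = 0 → x' τ = 0) ∧ (∀ S ∈ F, ∑ τ ∈ S, x' τ = ∑ τ ∈ S, x τ) ∧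
      (U.filter fun τ => x' τ ≠ 0).card ≤ typeBound F.card := by
  intro k
  induction k using Nat.strong_induction_on with
  | _ k ih =>
  intro x hk
  by_cases hle : k ≤ typeBound F.card
  · exact ⟨x, fun _ h => h, fun _ _ => rfl, hk ▸ hle⟩
  obtain ⟨u, hu, huc⟩ := Finset.exists_subset_card_eq (s := U.filter fun τ => x τ ≠ 0)
    (n := typeBound F.card) (by omega)
  -- Pigeonhole on the subsets of `u`, each sent to its intersection sizes with the members of `F`.
  -- Removing the common part of two colliding subsets gives the disjoint sets to exchange.
  obtain ⟨A, hA, B, hB, hAB, hf⟩ := Finset.exists_ne_map_eq_of_card_lt_of_maps_to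
    (s := u.powerset) (t := (Finset.univ : Finset (F → Fin (typeBound F.card + 1))))
    (f := fun A S => ⟨(A ∩ u ∩ S.1).card, Nat.lt_succ_of_le ((Finset.card_le_card
      (Finset.inter_subset_left.trans Finset.inter_subset_right)).trans huc.le)⟩)
    (by
      rw [Finset.card_powerset, huc, Finset.card_univ, Fintype.card_fun, Fintype.card_fin,
        Fintype.card_coe]
      exact lt_two_pow_typeBound _) (fun _ _ => Finset.mem_univ _)
  rw [Finset.mem_powerset] at hA hB
  have hcard : ∀ S ∈ F, ((A \ B) ∩ S).card = ((B \ A) ∩ S).card := by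
    intro S hS
    have h1 : (A ∩ u ∩ S).card = (B ∩ u ∩ S).card := congrArg Fin.val (congrFun hf ⟨S, hS⟩)
    rw [Finset.inter_eq_left.2 hA, Finset.inter_eq_left.2 hB] at h1
    have h2 : ∀ A B : Finset T, (A ∩ S).card = ((A \ B) ∩ S).card + (A ∩ B ∩ S).card := by
      intro A B
      rw [← Finset.card_union_of_disjoint, ← Finset.union_inter_distrib_right,
        Finset.sdiff_union_inter]
      exact (Finset.disjoint_sdiff_inter A B).mono Finset.inter_subset_left Finset.inter_subset_left
    have h3 := h2 A B
    have h4 := h2 B A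
    rw [Finset.inter_comm B A] at h4
    omega
  have hsupp : ∀ τ ∈ u, τ ∈ U ∧ x τ ≠ 0 := fun τ hτ => Finset.mem_filter.1 (hu hτ)
  have key : ∃ x' : T → ℕ, (∀ τ, x τ = 0 → x' τ = 0) ∧
      (∀ S ∈ F, ∑ τ ∈ S, x' τ = ∑ τ ∈ S, x τ) ∧ ∃ τ ∈ u, x' τ = 0 := by
    -- Only the set that loses weight must be nonempty; if `A \ B` is empty, the roles are swapped.
    rcases Finset.eq_empty_or_nonempty (A \ B) with he | hne
    · have hne : (B \ A).Nonempty := by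
        rw [Finset.nonempty_iff_ne_empty]
        intro he'
        exact hAB (Finset.Subset.antisymm (Finset.sdiff_eq_empty_iff_subset.1 he)
          (Finset.sdiff_eq_empty_iff_subset.1 he'))
      obtain ⟨x', h1, h2, τ, hτ, h3⟩ := exists_exchange F x (B \ A) (A \ B)
        disjoint_sdiff_sdiff hne (fun τ hτ => (hsupp τ (hA (Finset.mem_sdiff.1 hτ).1)).2)
        fun S hS => (hcard S hS).symm
      exact ⟨x', h1, h2, τ, hB (Finset.mem_sdiff.1 hτ).1, h3⟩
    · obtain ⟨x', h1, h2, τ, hτ, h3⟩ := exists_exchange F x (A \ B) (B \ A)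
        disjoint_sdiff_sdiff hne (fun τ hτ => (hsupp τ (hB (Finset.mem_sdiff.1 hτ).1)).2) hcard
      exact ⟨x', h1, h2, τ, hA (Finset.mem_sdiff.1 hτ).1, h3⟩
  obtain ⟨x', h1, h2, τ, hτ, h3⟩ := key
  have hlt : (U.filter fun τ => x' τ ≠ 0).card < k := by
    rw [← hk]
    refine Finset.card_lt_card ⟨fun σ hσ => ?_, fun h => ?_⟩
    · rw [Finset.mem_filter] at hσ ⊢
      exact ⟨hσ.1, fun h => hσ.2 (h1 σ h)⟩
    · exact (Finset.mem_filter.1 (h (hu hτ))).2 h3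
  obtain ⟨x'', h4, h5, h6⟩ := ih _ hlt x' rfl
  exact ⟨x'', fun σ h => h4 σ (h1 σ h), fun S hS => (h5 S hS).trans (h2 S hS), h6⟩

/-! ### Counting with a threshold -/

/-- If some summand reaches `N`, both sums are at least `n`; otherwise nothing is cut off. -/
theorem le_sum_min_iff {T : Type*} (s : Finset T) (c : T → ℕ∞) {n N : ℕ} (h : n ≤ N) :
    (n : ℕ∞) ≤ ∑ τ ∈ s, min (N : ℕ∞) (c τ) ↔ (n : ℕ∞) ≤ ∑ τ ∈ s, c τ := by
  refine ⟨fun h1 => h1.trans (Finset.sum_le_sum fun τ _ => min_le_right _ _), fun h1 => ?_⟩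
  by_cases h2 : ∃ τ ∈ s, (N : ℕ∞) ≤ c τ
  · obtain ⟨τ, hτ, h2⟩ := h2
    calc (n : ℕ∞) ≤ N := by exact_mod_cast h
      _ = min (N : ℕ∞) (c τ) := (min_eq_left h2).symm
      _ ≤ _ := Finset.single_le_sum (f := fun τ => min (N : ℕ∞) (c τ)) (fun _ _ => zero_le) hτ
  · push Not at h2
    rwa [Finset.sum_congr rfl fun τ hτ => min_eq_right (h2 τ hτ).le]

theorem le_sum_min_iff_nat {T : Type*} (s : Finset T) (c : T → ℕ) {n N : ℕ} (h : n ≤ N) :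
    n ≤ ∑ τ ∈ s, min N (c τ) ↔ n ≤ ∑ τ ∈ s, c τ := by
  have h1 := le_sum_min_iff s (fun τ => (c τ : ℕ∞)) h
  simp only [← Nat.mono_cast.map_min, ← Nat.cast_sum, Nat.cast_le] at h1
  exact h1

theorem encard_eq_sum_fibers {α T : Type*} [DecidableEq T] (W : Set α) (typ : α → T) (s : Finset T) :
    {w | w ∈ W ∧ typ w ∈ s}.encard = ∑ τ ∈ s, {w | w ∈ W ∧ typ w = τ}.encard := by
  induction s using Finset.induction_on with
  | empty => simp
  | insert τ s hτ ih =>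
    rw [Finset.sum_insert hτ, ← ih, ← Set.encard_union_eq]
    · congr 1
      ext w
      simp only [Set.mem_ofPred_eq, Finset.mem_insert, Set.mem_union]
      tauto
    · rw [Set.disjoint_left]
      rintro w ⟨_, rfl⟩ ⟨_, h⟩
      exact hτ h

/-- The size of a fiber, cut off at a threshold. -/
noncomputable def fiberCard {α T : Type*} (W : Set α) (typ : α → T) (N : ℕ) (τ : T) : ℕ :=
  (min (N : ℕ∞) {w | w ∈ W ∧ typ w = τ}.encard).toNat

theorem le_encard_iff {α T : Type*} [DecidableEq T] (W : Set α) (typ : α → T) (s : Finset T) {n N : ℕ}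
    (h : n ≤ N) : (n : ℕ∞) ≤ {w | w ∈ W ∧ typ w ∈ s}.encard ↔
      n ≤ ∑ τ ∈ s, fiberCard W typ N τ := by
  rw [encard_eq_sum_fibers, ← le_sum_min_iff s _ h, ← Nat.cast_le (α := ℕ∞), Nat.cast_sum]
  refine Eq.to_iff (congrArg _ (Finset.sum_congr rfl fun τ _ => ?_))
  -- The cut makes every fiber size finite, so passing to `ℕ` loses nothing.
  exact (ENat.natCast_toNat (ne_top_of_le_ne_top (ENat.natCast_ne_top N) (min_le_left _ _))).symm

theorem fiberCard_ne_zero_iff {α T : Type*} (W : Set α) (typ : α → T) {N : ℕ} (hN : N ≠ 0) (τ : T) :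
    fiberCard W typ N τ ≠ 0 ↔ ∃ w ∈ W, typ w = τ := by
  rw [fiberCard, Ne, ENat.toNat_eq_zero, not_or, and_iff_left
    (ne_top_of_le_ne_top (ENat.natCast_ne_top N) (min_le_left _ _))]
  constructor
  · intro h
    by_contra hn
    push Not at hn
    refine h ?_
    rw [Set.encard_eq_zero.2 (Set.eq_empty_of_forall_notMem fun w hw => hn w hw.1 hw.2)]
    exact min_eq_right zero_le
  · rintro ⟨w, hw, rfl⟩
    refine (lt_min ?_ ?_).ne'
    · exact_mod_cast Nat.pos_of_ne_zero hN
    · exact Set.encard_pos.2 ⟨w, hw, rfl⟩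

end TwoWayGraded

namespace TwoWayGraded

/-! ### Completeness -/

namespace Formula

/-- The propositional variables of a formula. -/
def vars : Formula → Finset ℕ
  | var i => {i}
  | top => ∅
  | bot => ∅
  | neg φ => φ.vars
  | and φ ψ => φ.vars ∪ ψ.vars
  | or φ ψ => φ.vars ∪ ψ.vars
  | imp φ ψ => φ.vars ∪ ψ.vars
  | iff φ ψ => φ.vars ∪ ψ.vars
  | dia _ φ => φ.vars
  | revDia _ φ => φ.vars

/-- The subscripts of the modal operators of a formula, with their arguments. -/
def modal : Formula → List (ℕ × Formula)
  | var _ => []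
  | top => []
  | bot => []
  | neg φ => φ.modal
  | and φ ψ => φ.modal ++ ψ.modal
  | or φ ψ => φ.modal ++ ψ.modal
  | imp φ ψ => φ.modal ++ ψ.modal
  | iff φ ψ => φ.modal ++ ψ.modal
  | dia n φ => (n, φ) :: φ.modal
  | revDia n φ => (n, φ) :: φ.modal

end Formula

/-! ### Bounds on numerals and on the variables and subscripts of a formula. -/

theorem length_numeral (n : ℕ) : (numeral n).length = (Computability.encodeNat n).length := by
  simp [numeral]

theorem card_vars_le (φ : Formula) : φ.vars.card ≤ φ.encode.length := by
  induction φ with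
  | var i => simp [Formula.vars, Formula.encode]
  | top | bot => simp [Formula.vars]
  | neg φ ih => simp [Formula.vars, Formula.encode]; omega
  | and φ ψ ih1 ih2 | or φ ψ ih1 ih2 | imp φ ψ ih1 ih2 | iff φ ψ ih1 ih2 =>
    have := Finset.card_union_le φ.vars ψ.vars
    simp [Formula.vars, Formula.encode]
    omega
  | dia n φ ih | revDia n φ ih => simp [Formula.vars, Formula.encode]; omega

theorem length_of_mem_vars {φ : Formula} {i : ℕ} (h : i ∈ φ.vars) :
    (Computability.encodeNat i).length ≤ φ.encode.length := by
  induction φ with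
  | var j =>
    rw [Formula.vars, Finset.mem_singleton] at h
    simp [Formula.encode, h, length_numeral]
  | top | bot => simp [Formula.vars] at h
  | neg φ ih => have := ih h; simp [Formula.encode]; omega
  | and φ ψ ih1 ih2 | or φ ψ ih1 ih2 | imp φ ψ ih1 ih2 | iff φ ψ ih1 ih2 =>
    rcases Finset.mem_union.1 h with h | h
    · have := ih1 h
      simp [Formula.encode]
      omega
    · have := ih2 h
      simp [Formula.encode]
      omega
  | dia n φ ih | revDia n φ ih => have := ih h; simp [Formula.encode]; omega

theorem length_modal_le (φ : Formula) : φ.modal.length ≤ φ.encode.length := by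
  induction φ with
  | var i | top | bot => simp [Formula.modal]
  | neg φ ih => simp [Formula.modal, Formula.encode]; omega
  | and φ ψ ih1 ih2 | or φ ψ ih1 ih2 | imp φ ψ ih1 ih2 | iff φ ψ ih1 ih2 =>
    simp [Formula.modal, Formula.encode]
    omega
  | dia n φ ih | revDia n φ ih => simp [Formula.modal, Formula.encode]; omega

theorem val_lt_two_pow (l : List Bool) : val l < 2 ^ l.length := by
  induction l with
  | nil => simp [val]
  | cons b l ih => cases b <;> simp [val, pow_succ] <;> omega

theorem le_of_mem_modal {φ χ : Formula} {n : ℕ} (h : (n, χ) ∈ φ.modal) :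
    n ≤ 2 ^ φ.encode.length := by
  have hmono : ∀ {a b : ℕ}, n ≤ 2 ^ a → a ≤ b → n ≤ 2 ^ b := fun h1 h2 =>
    h1.trans (Nat.pow_le_pow_right (by norm_num) h2)
  have hnum : ∀ m : ℕ, m ≤ 2 ^ (numeral m).length := fun m => by
    have := val_lt_two_pow (Computability.encodeNat m)
    rw [val_encodeNat, ← length_numeral] at this
    exact this.le
  induction φ with
  | var i | top | bot => simp [Formula.modal] at h
  | neg φ ih => exact hmono (ih h) (by simp [Formula.encode])
  | and φ ψ ih1 ih2 | or φ ψ ih1 ih2 | imp φ ψ ih1 ih2 | iff φ ψ ih1 ih2 =>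
    rcases List.mem_append.1 h with h | h
    · exact hmono (ih1 h) (by simp [Formula.encode]; omega)
    · exact hmono (ih2 h) (by simp [Formula.encode]; omega)
  | dia m φ ih | revDia m φ ih =>
    rcases List.mem_cons.1 h with h | h
    · obtain ⟨rfl, rfl⟩ := Prod.mk.inj h
      exact hmono (hnum n) (by simp [Formula.encode]; omega)
    · exact hmono (ih h) (by simp [Formula.encode]; omega)

theorem length_encodeNat_le {n k : ℕ} (h : n < 2 ^ k) : (Computability.encodeNat n).length ≤ k := by
  have key : ∀ p : PosNum, 2 ^ (Computability.encodePosNum p).length ≤ 2 * (p : ℕ) := by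
    intro p
    induction p with
    | one => simp [Computability.encodePosNum]
    | bit0 p ih => simp [Computability.encodePosNum, pow_succ]; omega
    | bit1 p ih => simp [Computability.encodePosNum, pow_succ]; omega
  rw [← Num.to_of_nat n] at h
  rw [Computability.encodeNat]
  cases hn : (n : Num) with
  | zero => exact Nat.zero_le _
  | pos p =>
    have h1 := key p
    rw [hn] at h
    have h2 : (2 : ℕ) ^ (Computability.encodePosNum p).length < 2 ^ (k + 1) := by
      rw [pow_succ]
      have h3 : (p : ℕ) < 2 ^ k := by simpa using h
      omega
    exact Nat.lt_succ_iff.1 ((Nat.pow_lt_pow_iff_right (by norm_num)).1 h2)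

theorem sz_list_le {α : Type} [Enc α] {K : ℕ} (l : List α) (h : ∀ b ∈ l, sz b ≤ K) :
    sz l ≤ 1 + l.length * (K + 1) := by
  induction l with
  | nil => simp
  | cons b l ih =>
    have h1 := h b (by simp)
    have h2 := ih fun b hb => h b (by simp [hb])
    simp only [sz_cons, List.length_cons, add_mul, one_mul]
    omega

/-- A bound on the size of certificates. -/
def certBound (n : ℕ) : ℕ :=
  -- There are `2 * n + 2` sums to preserve: two for each modal operator and two single types. An
  -- entry costs at most 3 for the flag, `4 * n + 1` for the number, `1 + n * (4 * n + 2)` for the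
  -- variables and 2 for pair nodes.
  1 + typeBound (2 * n + 2) * (((3 + (4 * n + 1) + (1 + n * (4 * n + 2))) + 2) + 1)

/-! ### Components of transitive Euclidean structures. -/

/-- The type of a world: whether it belongs to `C`, and the variables from `U` it satisfies. -/
noncomputable def worldType (A : KripkeStructure.{u}) (C : Set A.World) (U : Finset ℕ)
    (w : A.World) : Bool × Finset ℕ :=
  open Classical in (decide (w ∈ C), U.filter fun i => w ∈ A.V i)

/-- `W` is a generated set of worlds and `C` is the set of its worlds with predecessors. -/
structure IsComponent (A : KripkeStructure.{u}) (W C : Set A.World) : Prop where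
  sub : C ⊆ W
  succ : ∀ w ∈ W, ∀ v, A.R w v ↔ v ∈ C
  pred : ∀ v ∈ C, ∀ u, A.R u v ↔ u ∈ W
  init : ∀ v ∈ W, v ∉ C → ∀ u, ¬ A.R u v

/-- If `w` and `v` both see `c`, then a successor of either is seen from `c` by the Euclidean
property, hence from the other by transitivity. A world with a predecessor is reflexive, so within
this set it lies in `C`. -/
theorem isComponent_of_K45 (A : KripkeStructure.{u}) (h : K45 A.World A.R) (w : A.World) :
    IsComponent A {v | v = w ∨ ∃ c, A.R w c ∧ A.R v c} {v | A.R w v} := by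
  obtain ⟨ht, he⟩ := h
  have hs : ∀ v ∈ {v | v = w ∨ ∃ c, A.R w c ∧ A.R v c}, ∀ u, A.R v u ↔ u ∈ {v | A.R w v} := by
    rintro v (rfl | ⟨c, hwc, hvc⟩) u
    · rfl
    · exact ⟨fun h => ht _ _ _ hwc (he _ _ _ hvc h), fun h => ht _ _ _ hvc (he _ _ _ hwc h)⟩
  refine ⟨fun v hv => Or.inr ⟨v, hv, he _ _ _ hv hv⟩, hs, fun v hv u =>
    ⟨fun h => Or.inr ⟨v, hv, h⟩, fun h => (hs u h v).2 hv⟩, fun v hv hvC u huv => hvC ?_⟩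
  exact (hs v hv v).1 (he _ _ _ huv huv)

namespace IsComponent

variable {A : KripkeStructure.{u}} {W C : Set A.World}

theorem sat_dia (h : IsComponent A W C) {w : A.World} (hw : w ∈ W) (n : ℕ) (φ : Formula) : A.Sat w (.dia n φ) ↔
    (n : ℕ∞) ≤ {v | v ∈ W ∧ (v ∈ C ∧ A.Sat v φ)}.encard := by
  rw [KripkeStructure.Sat]
  congr! 3
  ext v
  rw [h.succ w hw]
  exact ⟨fun hv => ⟨h.sub hv.1, hv⟩, fun hv => hv.2⟩

open Classical in
theorem sat_revDia (h : IsComponent A W C) {w : A.World} (hw : w ∈ W) (n : ℕ) (φ : Formula) : A.Sat w (.revDia n φ) ↔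
    if w ∈ C then (n : ℕ∞) ≤ {v | v ∈ W ∧ A.Sat v φ}.encard else n = 0 := by
  rw [KripkeStructure.Sat]
  split_ifs with hC
  · congr! 3
    ext v
    rw [h.pred w hC]
  · have h1 : {v | A.R v w ∧ A.Sat v φ} = ∅ :=
      Set.eq_empty_of_forall_notMem fun v hv => h.init w hw hC v hv.1
    rw [h1]
    simp

-- Only the Boolean cases use induction: the sets counted by modal operators do not depend on the
-- world of `W`, apart from its membership in `C`.
open Classical in
theorem sat_congr (h : IsComponent A W C) {U : Finset ℕ} (φ : Formula) (hU : φ.vars ⊆ U) {w w' : A.World} (hw : w ∈ W)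
    (hw' : w' ∈ W) (ht : worldType A C U w = worldType A C U w') : A.Sat w φ ↔ A.Sat w' φ := by
  have hC : w ∈ C ↔ w' ∈ C := by
    simpa [worldType] using congrArg Prod.fst ht
  induction φ with
  | var i =>
    have h1 := congrArg (fun t => i ∈ t.2) ht
    have hi : i ∈ U := hU (Finset.mem_singleton_self i)
    simpa [worldType, hi, KripkeStructure.Sat] using h1
  | top | bot => rfl
  | neg φ ih => simp only [KripkeStructure.Sat, ih hU]
  | and φ ψ ih1 ih2 | or φ ψ ih1 ih2 | imp φ ψ ih1 ih2 | iff φ ψ ih1 ih2 =>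
    simp only [KripkeStructure.Sat, ih1 (Finset.union_subset_left hU),
      ih2 (Finset.union_subset_right hU)]
  | dia n φ ih => rw [h.sat_dia hw, h.sat_dia hw']
  | revDia n φ ih => rw [h.sat_revDia hw, h.sat_revDia hw', if_congr hC rfl rfl]

-- Small certificates exist: a short list whose entries mimic worlds of `W`. The world `w₀` keeps
-- local satisfaction alive, and `w₁` will be a successor in the serial case.
open Classical in
theorem exists_entries (h : IsComponent A W C) (φ : Formula) (w₀ : A.World) (hw₀ : w₀ ∈ W) (w₁ : A.World) (hw₁ : w₁ ∈ W) :
    ∃ L : List Entry, sz L ≤ certBound φ.encode.length ∧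
      (∀ e ∈ L, ∃ w ∈ W, (e.1 = true ↔ w ∈ C) ∧ (esat L φ e = true ↔ A.Sat w φ)) ∧
      (∃ e ∈ L, esat L φ e = true ↔ A.Sat w₀ φ) ∧ ∃ e ∈ L, e.1 = true ↔ w₁ ∈ C := by
  set k := φ.encode.length with hk
  -- A threshold that no subscript in `φ` exceeds, with binary numerals of length linear in `k`.
  let N : ℕ := 2 ^ k
  have hN : N ≠ 0 := by positivity
  let typ : A.World → Bool × Finset ℕ := worldType A C φ.vars
  let T : Finset (Bool × Finset ℕ) := Finset.univ ×ˢ φ.vars.powerset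
  have hT : ∀ w, typ w ∈ T := fun w => by
    simp [T, typ, worldType, Finset.filter_subset, Classical.em]
  have hfst : ∀ w, (typ w).1 = true ↔ w ∈ C := fun w => by simp [typ, worldType]
  let x := fiberCard W typ N
  -- Truth at a type. By `sat_congr` the choice of the world of that type is immaterial for
  -- subformulas of `φ`.
  let Q : Formula → Bool × Finset ℕ → Prop := fun χ τ => ∃ w ∈ W, typ w = τ ∧ A.Sat w χ
  have hQ : ∀ χ, χ.vars ⊆ φ.vars → ∀ w ∈ W, (Q χ (typ w) ↔ A.Sat w χ) := fun χ hχ w hw =>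
    ⟨fun ⟨w', hw', ht, hs⟩ => (h.sat_congr χ hχ hw' hw ht).1 hs, fun hs => ⟨w, hw, rfl, hs⟩⟩
  let sel : (Bool × Finset ℕ → Prop) → Finset (Bool × Finset ℕ) := fun p => T.filter p
  have hsel : ∀ p τ, τ ∈ sel p ↔ τ ∈ T ∧ p τ := fun _ _ => Finset.mem_filter
  let SC : Formula → Finset (Bool × Finset ℕ) := fun χ => sel fun τ => Q χ τ ∧ τ.1 = true
  let SW : Formula → Finset (Bool × Finset ℕ) := fun χ => sel (Q χ)
  let F₁ : Finset (Finset (Bool × Finset ℕ)) := (φ.modal.map fun p => SC p.2).toFinset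
  let F₂ : Finset (Finset (Bool × Finset ℕ)) := (φ.modal.map fun p => SW p.2).toFinset
  -- Preserving the sums over these singletons keeps the types of `w₀` and `w₁` occupied.
  let F₃ : Finset (Finset (Bool × Finset ℕ)) := {{typ w₀}, {typ w₁}}
  let F := F₁ ∪ F₂ ∪ F₃
  have hF : F.card ≤ 2 * k + 2 := by
    have h1 := length_modal_le φ
    have h2 : F.card ≤ (F₁ ∪ F₂).card + F₃.card := Finset.card_union_le _ _
    have h3 : (F₁ ∪ F₂).card ≤ F₁.card + F₂.card := Finset.card_union_le _ _
    have h4 : F₁.card ≤ _ := List.toFinset_card_le _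
    have h5 : F₂.card ≤ _ := List.toFinset_card_le _
    have h6 : F₃.card ≤ 2 := Finset.card_le_two
    rw [List.length_map] at h4 h5
    omega
  obtain ⟨x', hx0, hxF, hxc⟩ := exists_small_support T F _ x rfl
  -- Exchanges can push the numbers above `N`, so they are cut off once more to keep their binary
  -- expansions short.
  let y : Bool × Finset ℕ → ℕ := fun τ => min N (x' τ)
  have hy : ∀ τ, y τ ≠ 0 ↔ x' τ ≠ 0 := fun τ => by
    simp only [y, ne_eq, Nat.min_eq_zero_iff, hN, false_or]
  let S : Finset (Bool × Finset ℕ) := T.filter fun τ => y τ ≠ 0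
  have hS : ∀ τ ∈ S, ∃ w ∈ W, typ w = τ := by
    intro τ hτ
    have h1 := (hy τ).1 (Finset.mem_filter.1 hτ).2
    exact (fiberCard_ne_zero_iff W typ hN τ).1 fun h2 => h1 (hx0 τ h2)
  let f : Bool × Finset ℕ → Entry := fun τ =>
    -- The number minus one is recorded; `S` contains only types with `y τ ≠ 0`, so the subtraction
    -- is exact there.
    (τ.1, Computability.encodeNat (y τ - 1), τ.2.toList.map Computability.encodeNat)
  let L := S.toList.map f
  have hmem : ∀ w, w ∈ W → {typ w} ∈ F → typ w ∈ S := by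
    intro w hw hwF
    have h1 := hxF _ hwF
    rw [Finset.sum_singleton, Finset.sum_singleton] at h1
    refine Finset.mem_filter.2 ⟨hT w, (hy _).2 ?_⟩
    rw [h1]
    exact (fiberCard_ne_zero_iff W typ hN _).2 ⟨w, hw, rfl⟩
  have hw : ∀ τ ∈ S, weight (f τ) = y τ := by
    intro τ hτ
    have := (Finset.mem_filter.1 hτ).2
    simp only [weight, f, val_encodeNat]
    omega
  -- Types without an entry have `y τ = 0`, so the sum over entries is a sum over all selected
  -- types.
  have hsum : ∀ (g : Entry → Bool) (p : Bool × Finset ℕ → Prop),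
      (∀ τ ∈ S, g (f τ) = true ↔ p τ) →
      (L.map fun e => if g e = true then weight e else 0).sum = ∑ τ ∈ sel p, y τ := by
    intro g p hgp
    rw [List.map_map, Finset.sum_map_toList, Finset.sum_filter]
    rw [Finset.sum_filter]
    refine Finset.sum_congr rfl fun τ hτ => ?_
    by_cases h1 : y τ = 0
    · simp [h1]
    · have h2 : τ ∈ S := Finset.mem_filter.2 ⟨hτ, h1⟩
      simp only [Function.comp, ne_eq, h1, not_false_eq_true, if_true, hw τ h2]
      exact if_congr (hgp τ h2) rfl rfl
  -- Comparisons with `n ≤ N` survive both cuts, and between them the sums over members of `F` are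
  -- preserved.
  have hcount : ∀ (n : ℕ) (R : Finset (Bool × Finset ℕ)), n ≤ N → R ∈ F →
      (n ≤ ∑ τ ∈ R, y τ ↔ (n : ℕ∞) ≤ {w | w ∈ W ∧ typ w ∈ R}.encard) := by
    intro n R hn hR
    rw [le_encard_iff W typ R hn, le_sum_min_iff_nat R x' hn, hxF R hR]
  -- The inclusions of variables and modal subformulas ensure that every sum met in the induction
  -- runs over a member of `F`.
  have key : ∀ χ : Formula, χ.vars ⊆ φ.vars → χ.modal ⊆ φ.modal → ∀ w ∈ W, typ w ∈ S →
      (esat L χ (f (typ w)) = true ↔ A.Sat w χ) := by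
    intro χ
    induction χ with
    | var i =>
      intro hv _ w hw _
      have hi : i ∈ φ.vars := hv (Finset.mem_singleton_self i)
      have hinj : ∀ a, Computability.encodeNat a = Computability.encodeNat i ↔ a = i := fun a =>
        ⟨fun h => by rw [← val_encodeNat a, h, val_encodeNat], fun h => h ▸ rfl⟩
      simp [esat, f, typ, worldType, hinj, hi, KripkeStructure.Sat]
    | top | bot => intros; simp [esat, KripkeStructure.Sat]
    | neg χ ih =>
      intro hv hm w hw hS
      simp [esat, KripkeStructure.Sat, ← ih hv hm w hw hS]
    | and χ ψ ih1 ih2 | or χ ψ ih1 ih2 | imp χ ψ ih1 ih2 | iff χ ψ ih1 ih2 =>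
      intro hv hm w hw hS
      simp only [Formula.modal, List.append_subset] at hm
      rw [KripkeStructure.Sat, ← ih1 (Finset.union_subset_left hv) hm.1 w hw hS,
        ← ih2 (Finset.union_subset_right hv) hm.2 w hw hS, esat]
      cases esat L χ (f (typ w)) <;> cases esat L ψ (f (typ w)) <;> simp
    | dia n χ ih =>
      intro hv hm w hw _
      have hmem : (n, χ) ∈ φ.modal := hm (List.mem_cons_self ..)
      have ih' := ih hv fun p hp => hm (List.mem_cons_of_mem _ hp)
      have hR : SC χ ∈ F := by
        refine Finset.mem_union_left _ (Finset.mem_union_left _ ?_)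
        exact List.mem_toFinset.2 (List.mem_map.2 ⟨_, hmem, rfl⟩)
      rw [esat, decide_eq_true_iff, hsum (fun e => esat L χ e && e.1) fun τ => Q χ τ ∧ τ.1 = true,
        h.sat_dia hw]
      · refine (hcount n (SC χ) (le_of_mem_modal hmem) hR).trans ?_
        congr! 3
        ext v
        refine and_congr_right fun hv' => ?_
        rw [hsel, and_iff_right (hT v), hQ χ hv v hv', hfst, and_comm]
      · intro τ hτ
        obtain ⟨v, hv', rfl⟩ := hS τ hτ
        rw [Bool.and_eq_true, ih' v hv' hτ, hQ χ hv v hv']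
    | revDia n χ ih =>
      intro hv hm w hw _
      have hmem : (n, χ) ∈ φ.modal := hm (List.mem_cons_self ..)
      have ih' := ih hv fun p hp => hm (List.mem_cons_of_mem _ hp)
      have hR : SW χ ∈ F := by
        refine Finset.mem_union_left _ (Finset.mem_union_right _ ?_)
        exact List.mem_toFinset.2 (List.mem_map.2 ⟨_, hmem, rfl⟩)
      rw [esat, decide_eq_true_iff, hsum (esat L χ) (Q χ), h.sat_revDia hw]
      · by_cases hwC : w ∈ C
        · rw [if_pos ((hfst w).2 hwC), if_pos hwC]
          refine (hcount n (SW χ) (le_of_mem_modal hmem) hR).trans ?_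
          congr! 3
          ext v
          refine and_congr_right fun hv' => ?_
          rw [hsel, and_iff_right (hT v), hQ χ hv v hv']
        · rw [if_neg (fun h => hwC ((hfst w).1 h)), if_neg hwC, Nat.le_zero]
      · intro τ hτ
        obtain ⟨v, hv', rfl⟩ := hS τ hτ
        rw [ih' v hv' hτ, hQ χ hv v hv']
  have hin : ∀ w ∈ W, {typ w} ∈ F → f (typ w) ∈ L := fun w hw hwF =>
    List.mem_map.2 ⟨_, Finset.mem_toList.2 (hmem w hw hwF), rfl⟩
  have hF₀ : {typ w₀} ∈ F := by simp [F, F₃]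
  have hF₁ : {typ w₁} ∈ F := by simp [F, F₃]
  refine ⟨L, ?_, ?_, ⟨_, hin w₀ hw₀ hF₀, ?_⟩, ⟨_, hin w₁ hw₁ hF₁, hfst w₁⟩⟩
  · have h1 : ∀ e ∈ L, sz e ≤ (3 + (4 * k + 1) + (1 + k * (4 * k + 2))) + 2 := by
      intro e he
      obtain ⟨τ, hτ, rfl⟩ := List.mem_map.1 he
      rw [Finset.mem_toList] at hτ
      have hτT := (Finset.mem_filter.1 hτ).1
      have hτv : τ.2 ⊆ φ.vars := Finset.mem_powerset.1 (Finset.mem_product.1 hτT).2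
      have h2 := sz_bool_le τ.1
      have h3 : sz (Computability.encodeNat (y τ - 1)) ≤ 4 * k + 1 := by
        refine (sz_bits_le _).trans ?_
        have h4 : y τ - 1 < 2 ^ k := by
          have h5 : y τ ≤ N := min_le_left _ _
          have h6 : 0 < N := Nat.pos_of_ne_zero hN
          have h7 : N = 2 ^ k := rfl
          omega
        have := length_encodeNat_le h4
        omega
      have h4 : sz (τ.2.toList.map Computability.encodeNat) ≤ 1 + k * (4 * k + 2) := by
        refine (sz_list_le (K := 4 * k + 1) _ ?_).trans ?_
        · intro l hl
          obtain ⟨i, hi, rfl⟩ := List.mem_map.1 hl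
          have := length_of_mem_vars (hτv (Finset.mem_toList.1 hi))
          refine (sz_bits_le _).trans ?_
          omega
        · rw [List.length_map, Finset.length_toList]
          gcongr
          exact (Finset.card_le_card hτv).trans (card_vars_le φ)
      simp only [f, sz_pair]
      omega
    refine (sz_list_le L h1).trans ?_
    rw [certBound]
    gcongr
    rw [List.length_map, Finset.length_toList]
    have h2 : S = T.filter fun τ => x' τ ≠ 0 := Finset.filter_congr fun τ _ => hy τ
    rw [h2]
    refine hxc.trans ?_
    unfold typeBound
    gcongr
  · intro e he
    obtain ⟨τ, hτ, rfl⟩ := List.mem_map.1 he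
    rw [Finset.mem_toList] at hτ
    obtain ⟨w, hw, rfl⟩ := hS τ hτ
    exact ⟨w, hw, hfst w, key φ subset_rfl (fun _ h => h) w hw hτ⟩
  · exact key φ subset_rfl (fun _ h => h) w₀ hw₀ (hmem w₀ hw₀ hF₀)

end IsComponent

/-- Every entry mimics a world of the component, so global truth passes to the entries; in the local
case the entry of `w₀` suffices. -/
theorem exists_accepts {glob serial : Bool} {φ : Formula} (h : Satisfiable.{u} glob serial φ) :
    ∃ L, sz L ≤ certBound φ.encode.length ∧ Accepts glob serial L φ := by
  obtain ⟨A, ⟨hK, hs⟩, hA⟩ := h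
  have hw₀ : ∃ w₀, A.Sat w₀ φ := by
    cases glob with
    | true =>
      obtain ⟨w⟩ := A.nonempty
      exact ⟨w, hA w⟩
    | false => exact hA
  obtain ⟨w₀, hw₀⟩ := hw₀
  have hc := isComponent_of_K45 A hK w₀
  have hw₁ : ∃ w₁ ∈ {v | v = w₀ ∨ ∃ c, A.R w₀ c ∧ A.R v c}, serial = true → A.R w₀ w₁ := by
    cases serial with
    | false => exact ⟨w₀, Or.inl rfl, by simp⟩
    | true =>
      obtain ⟨w₁, h1⟩ := hs rfl w₀
      exact ⟨w₁, hc.sub h1, fun _ => h1⟩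
  obtain ⟨w₁, hw₁, hw₁'⟩ := hw₁
  obtain ⟨L, h1, h2, ⟨e, he, he'⟩, e', he₁, he₁'⟩ := hc.exists_entries φ w₀ (Or.inl rfl) w₁ hw₁
  refine ⟨L, h1, ?_, fun h => ⟨e', he₁, he₁'.2 (hw₁' h)⟩⟩
  cases glob with
  | true =>
    refine ⟨List.ne_nil_of_mem he, fun e he => ?_⟩
    obtain ⟨w, -, -, h3⟩ := h2 e he
    exact h3.2 (hA w)
  | false => exact ⟨e, he, he'.2 hw₀⟩

/-! ### Membership in NP -/

open Polynomial in
theorem inNP_satisfiable (glob serial : Bool) :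
    InNP {x | ∃ φ : Formula, φ.encode = x ∧ Satisfiable.{u} glob serial φ} := by
  -- The polynomial is `certBound` written out; the certificate is the prefix notation of the coded
  -- list of entries.
  refine ⟨1 + ((2 * X + 2) * (2 * (2 * X + 2) + 2) + 1) *
      (((3 + (4 * X + 1) + (1 + X * (4 * X + 2))) + 2) + 1),
    fun p => verifier glob serial (p.1.map Sum.inl ++ p.2.map Sum.inr).reverse,
    (PT.verifier glob serial).computable, fun x => ?_⟩
  simp only [verifier_iff]
  constructor
  · rintro ⟨φ, rfl, h⟩
    obtain ⟨L, hL, hA⟩ := exists_accepts h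
    refine ⟨(Enc.enc L).ser, ?_, φ, rfl, ?_⟩
    · refine hL.trans_eq ?_
      simp [certBound, typeBound]
    · rwa [readTree_reverse, toEntries_enc]
  · rintro ⟨y, -, φ, rfl, h⟩
    exact ⟨φ, rfl, satisfiable_of_accepts h⟩

/-! ### The four problems as instances of `Satisfiable`. -/

theorem localSat_K45 : localSat K45.{u} =
    {x | ∃ φ : Formula, φ.encode = x ∧ Satisfiable.{u} false false φ} := by
  simp [localSat, LocallySatisfiable, Satisfiable]
  rfl

theorem globalSat_K45 : globalSat K45.{u} =
    {x | ∃ φ : Formula, φ.encode = x ∧ Satisfiable.{u} true false φ} := by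
  simp [globalSat, GloballySatisfiable, Satisfiable]
  rfl

theorem localSat_D45 : localSat D45.{u} =
    {x | ∃ φ : Formula, φ.encode = x ∧ Satisfiable.{u} false true φ} := by
  simp [localSat, LocallySatisfiable, Satisfiable, D45, and_comm]
  rfl

theorem globalSat_D45 : globalSat D45.{u} =
    {x | ∃ φ : Formula, φ.encode = x ∧ Satisfiable.{u} true true φ} := by
  simp [globalSat, GloballySatisfiable, Satisfiable, D45, and_comm]
  rfl

end TwoWayGraded

theorem mainTheorem3 :
    TwoWayGraded.InNP (TwoWayGraded.localSat TwoWayGraded.K45.{u}) ∧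
    TwoWayGraded.InNP (TwoWayGraded.globalSat TwoWayGraded.K45.{u}) ∧
    TwoWayGraded.InNP (TwoWayGraded.localSat TwoWayGraded.D45.{u}) ∧
    TwoWayGraded.InNP (TwoWayGraded.globalSat TwoWayGraded.D45.{u}) := by
  rw [TwoWayGraded.localSat_K45, TwoWayGraded.globalSat_K45, TwoWayGraded.localSat_D45,
    TwoWayGraded.globalSat_D45]
  exact ⟨TwoWayGraded.inNP_satisfiable _ _, TwoWayGraded.inNP_satisfiable _ _,
    TwoWayGraded.inNP_satisfiable _ _, TwoWayGraded.inNP_satisfiable _ _⟩
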